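/- **Setting.** Let $P$ be a probability distribution on labeled examples $(x,y)\in X\times\{0,1\}$, let $\mathcal H$ be a finite nonempty class of measurable hypotheses $h:X\to\{0,1\}$ of VC dimension at most $d$, where $d\ge 1$, and let $D=(D_1,\dots,D_n)$, $n\ge 2$, be drawn iid from $P$. Put $\mathrm{err}(h)=P(h(x)\ne y)$ and $\widehat{\mathrm{err}}(h,D)=\frac1n|\{j: h \text{ misclassifies } D_j\}|$, and let $\alpha,\delta,\delta_0\in(0,1)$. Write $\rho=\sqrt{d\log(n/\delta_0)/n}$. **Mechanism.** The large margin mechanism $\mathrm{LMM}(\alpha,\delta,D)$ with universe $\mathcal H$, $K=|\mathcal H|$, and objective $f(h)=1-\widehat{\mathrm{err}}(h,D)$ works as follows. Let $f^{(r)}$ be the $r$-th highest value of $f$ on $\mathcal H$, let $t^{(r)}=\frac6n\bigl(1+\frac{\ln(3r/\delta)}{\alpha}\bigr)$ and $T^{(r)}=\frac{3}{n\alpha}\ln\frac{3}{2\delta}+\frac{6}{n\alpha}\ln\frac3\delta+\frac{12}{n\alpha}\ln\frac{3r(r+1)}{\delta}+t^{(r)}$. Draw independent Laplace variables $Z\sim\mathrm{Lap}(3/\alpha)$,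 $G\sim\mathrm{Lap}(6/\alpha)$, $Z_1,\dots,Z_{K-1}\sim\mathrm{Lap}(12/\alpha)$. Let $\ell$ be the least $\ell<K$ with $f^{(1)}+Z/n-f^{(\ell+1)}>(Z_\ell+G)/n+T^{(\ell)}$, or $\ell=K$ if there is none. Let $\mathcal U_\ell$ be a set of $\ell$ hypotheses with highest $f$ (ties broken arbitrarily), and return $h_{\mathrm{LMM}}\in\mathcal U_\ell$ drawn with probability proportional to $\exp(n\alpha f(h)/6)$. **Shells.** Let $c_0=c_0(\mathcal H,P,d,n,\delta_0)$ be the smallest (infimal) $c>0$ such that, with probability at least $1-\delta_0$, $|\widehat{\mathrm{err}}(h,D)-\mathrm{err}(h)|\le c\,\rho$ for all $h\in\mathcal H$. For $C_0>0$ and $C>0$ let $$\mathcal H(t)=\Bigl\{h\in\mathcal H:\ \mathrm{err}(h)\le\min_{h'\in\mathcal H}\mathrm{err}(h')+C_0\,t\,\rho\Bigr\},$$ and let $t^*=t^*(n)$ be the smallest positive integer $t$ with $\frac{\log|\mathcal H(t+1)|+\log(1/\delta)}{t}\le\frac{C_0\,\alpha\sqrt{d\,n\log n}}{C}$. **Claim.**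 There is an absolute constant $A>0$, and for every $\theta>0$ there is a constant $B=B(\theta)>0$, such that the following holds for all data as above, all tie-breaking rules, all $C\ge B$ and all $C_0\geq c_0$, $C_0>0$, for which $C_0\ge(1+\theta)c_0$ or $t^*(n)\ge2$. With probability at least $1-\delta_0-\delta$ over $D$ and the randomness of the mechanism, $$\mathrm{err}(h_{\mathrm{LMM}})\le\min_{h\in\mathcal H}\mathrm{err}(h)+A\left(\sqrt{\frac{d\log(n/\delta_0)}{n}}+\frac{\log(|\mathcal H(t^*(n)+1)|/\delta)}{\alpha n}\right).$$ -/

import Mathlib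

open MeasureTheory
open scoped ENNReal

noncomputable section

namespace PrivMax

/-! ### The large margin mechanism

In this section `H` is the finite universe of items, `f i` is the value `f(i, D)` of the item `i`
on the given dataset `D`, and `n` is the number of records of `D`. -/

/-- The centered Laplace distribution with scale `b > 0`. -/
def laplace (b : ℝ) : Measure ℝ :=
  volume.withDensity fun x => ENNReal.ofReal ((2 * b)⁻¹ * Real.exp (-|x| / b))

/-- The `ℓ`-th highest value (counted with multiplicity, `1 ≤ ℓ ≤ |H|`) of `f` on `H`:
the largest `v` such that at least `ℓ` items have value at least `v`. -/
def kthHighest {ι : Type*} (H : Finset ι) (f : ι → ℝ) (ℓ : ℕ) : ℝ :=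
  sSup {v : ℝ | ℓ ≤ (H.filter fun i => v ≤ f i).card}

/-- The quantity `t^(r)` of the mechanism. -/
def tThreshold (n : ℕ) (α δ : ℝ) (r : ℕ) : ℝ :=
  6 / n * (1 + Real.log (3 * r / δ) / α)

/-- The threshold `T^(r)` of the mechanism. -/
def bigThreshold (n : ℕ) (α δ : ℝ) (r : ℕ) : ℝ :=
  3 / (n * α) * Real.log (3 / (2 * δ)) + 6 / (n * α) * Real.log (3 / δ)
    + 12 / (n * α) * Real.log (3 * r * (r + 1) / δ) + tThreshold n α δ r

/-- The rank `ℓ` with which the while-loop ends, given the noise variables `Z`, `G` and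
`Z_1, …, Z_{K-1}` (`Zs r` is `Z_{r+1}`), where `K = |H|`: the first `ℓ < K` that passes the test,
and `K` if there is none. -/
def lmmRank {ι : Type*} (n : ℕ) (α δ : ℝ) (H : Finset ι) (f : ι → ℝ)
    (Z G : ℝ) (Zs : Fin (H.card - 1) → ℝ) : ℕ :=
  sInf ({H.card} ∪ {ℓ : ℕ | ∃ r : Fin (H.card - 1), ℓ = (r : ℕ) + 1 ∧
    (kthHighest H f 1 + Z / n) - kthHighest H f (ℓ + 1)
      > (Zs r + G) / n + bigThreshold n α δ ℓ})

/-- `U` consists of `ℓ` items of `H` with highest values of `f` (ties broken in some way). -/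
def IsTopSet {ι : Type*} (H : Finset ι) (f : ι → ℝ) (ℓ : ℕ) (U : Finset ι) : Prop :=
  U ⊆ H ∧ U.card = ℓ ∧ ∀ i ∈ U, ∀ j ∈ H, j ∉ U → f j ≤ f i

/-- The probability that the exponential mechanism on `U` with inverse temperature `β` returns
the item `i`: proportional to `1{i ∈ U} exp (β f i)`. -/
def expMech {ι : Type*} (β : ℝ) (f : ι → ℝ) (U : Finset ι) (i : ι) : ℝ :=
  (U : Set ι).indicator (fun i => Real.exp (β * f i)) i / ∑ j ∈ U, Real.exp (β * f j)

/-- The joint law of the independent noise variables `Z ∼ Lap(3/α)`, `G ∼ Lap(6/α)` and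
`Z_1, …, Z_{K-1} ∼ Lap(12/α)`. -/
def lmmNoise (α : ℝ) (K : ℕ) : Measure (ℝ × ℝ × (Fin (K - 1) → ℝ)) :=
  (laplace (3 / α)).prod ((laplace (6 / α)).prod (Measure.pi fun _ => laplace (12 / α)))

/-- The probability that the item returned by the large margin mechanism `LMM(α, δ, D)` lies
in `S`. Here `top ℓ` is the set of `ℓ` items with highest value that the tie-breaking rule
chooses. -/
def lmmProb {ι : Type*} (n : ℕ) (α δ : ℝ) (H : Finset ι) (f : ι → ℝ) (top : ℕ → Finset ι)
    (S : Set ι) : ℝ≥0∞ :=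
  ∫⁻ w, ∑ i ∈ H, S.indicator (fun i => ENNReal.ofReal
      (expMech (n * α / 6) f (top (lmmRank n α δ H f w.1 w.2.1 w.2.2)) i)) i
    ∂(lmmNoise α H.card)

/-! ### The learning problem

Hypotheses are functions `X → Bool`, a labeled example is an element of `X × Bool`, and `P` is the
distribution of a labeled example. -/

/-- The finite set `s` is shattered by `H`: every labeling of `s` is realized by some `h ∈ H`. -/
def Shatters {X : Type*} (H : Finset (X → Bool)) (s : Finset X) : Prop :=
  ∀ b : X → Bool, ∃ h ∈ H, ∀ x ∈ s, h x = b x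

/-- The VC dimension of a (nonempty) finite class: the largest size of a shattered set. -/
def vcDim {X : Type*} (H : Finset (X → Bool)) : ℕ :=
  sSup {k : ℕ | ∃ s : Finset X, s.card = k ∧ Shatters H s}

/-- The error of `h`: the probability that it misclassifies a random example. -/
def err {X : Type*} [MeasurableSpace X] (P : Measure (X × Bool)) (h : X → Bool) : ℝ :=
  P.real {z | h z.1 ≠ z.2}

/-- The empirical error of `h` on the dataset `D`. -/
def empErr {X : Type*} {n : ℕ} (h : X → Bool) (D : Fin n → X × Bool) : ℝ :=
  ((Finset.univ.filter fun j => h (D j).1 ≠ (D j).2).card : ℝ) / n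

/-- The least error `min_{h ∈ H} err(h)`. -/
def minErr {X : Type*} [MeasurableSpace X] (P : Measure (X × Bool)) (H : Finset (X → Bool))
    (hH : H.Nonempty) : ℝ :=
  H.inf' hH (err P)

/-- The rate `√(d log(n/δ₀)/n)`. -/
def rate (d n : ℕ) (δ₀ : ℝ) : ℝ :=
  Real.sqrt (d * Real.log (n / δ₀) / n)

/-- The smallest constant in the uniform convergence bound: the least `c` such that, with
probability at least `1 - δ₀` over `n` iid examples, `|empErr h D - err h| ≤ c √(d log(n/δ₀)/n)`
for all `h ∈ H`. -/
def ucConstant {X : Type*} [MeasurableSpace X] (P : Measure (X × Bool)) (H : Finset (X → Bool))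
    (d n : ℕ) (δ₀ : ℝ) : ℝ :=
  sInf {c : ℝ | 0 < c ∧ ENNReal.ofReal (1 - δ₀) ≤
    (Measure.pi fun _ : Fin n => P)
      {D | ∀ h ∈ H, |empErr h D - err P h| ≤ c * rate d n δ₀}}

/-- The `t`-th shell of `H`, with shell width `C₀ √(d log(n/δ₀)/n)`. -/
def shell {X : Type*} [MeasurableSpace X] (P : Measure (X × Bool)) (H : Finset (X → Bool))
    (hH : H.Nonempty) (d n : ℕ) (δ₀ C₀ : ℝ) (t : ℕ) : Finset (X → Bool) :=
  H.filter fun h => err P h ≤ minErr P H hH + C₀ * t * rate d n δ₀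

/-- `t*(n)`: the least positive integer `t` with
`(log |H(t+1)| + log(1/δ)) / t ≤ C₀ α √(d n log n) / C`. Such `t` exist as soon as
`α, C₀, C > 0`, `d ≥ 1` and `n ≥ 2`. -/
def tStar {X : Type*} [MeasurableSpace X] (P : Measure (X × Bool)) (H : Finset (X → Bool))
    (hH : H.Nonempty) (d n : ℕ) (α δ δ₀ C₀ C : ℝ) : ℕ :=
  sInf {t : ℕ | 0 < t ∧
    (Real.log ((shell P H hH d n δ₀ C₀ (t + 1)).card : ℝ) + Real.log (1 / δ)) / t
      ≤ C₀ * α * Real.sqrt (d * n * Real.log n) / C}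

end PrivMax

end

open PrivMax

/-! By the Vapnik–Chervonenkis inequality (symmetrization, random swaps of a double sample,
Sauer's lemma and Hoeffding's inequality) `c₀ ≤ 8`, and the infimum defining `c₀` is attained; so
with probability at least `1 - δ₀` all empirical errors are within `c₀ ρ` of the true ones. On
that event, if `m` hypotheses lie in the shell `t* + 1`, the `(m + 1)`-st highest value of `f` is
below the highest one by at least `C₀ (t* + 1) ρ - 2 c₀ ρ ≥ κ C₀ t* ρ`, where `κ` depends on `θ`
only. By the choice of `t*` this is at least `κ C log (m / δ) / (α n)`, which for `C ≥ B` pays for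
the noise and the threshold `T^(m)`. Hence the loop stops at a rank at most `m`, and the
exponential mechanism on at most `m` items loses `O(log (m / δ) / (α n))`.

This needs `log (m / δ)` to be bounded below, because the thresholds contain additive constants.
When `δ` is so close to `1` that it is not, a success probability of `1 - δ` is small, and it is
already attained when a large `Z` stops the loop at rank `1`. -/

namespace PrivMax

section Hoeffding

variable {ι : Type*} [Fintype ι] {Ω : ι → Type*} [∀ j, MeasurableSpace (Ω j)]
  {μ : ∀ j, Measure (Ω j)} [∀ j, IsProbabilityMeasure (μ j)] {f : ∀ j, Ω j → ℝ} {a b : ι → ℝ}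

lemma measureReal_pi_sum_ge_le (hf : ∀ j, Measurable (f j))
    (hab : ∀ j x, f j x ∈ Set.Icc (a j) (b j)) (h0 : ∀ j, ∫ x, f j x ∂μ j = 0) {s : ℝ}
    (hs : 0 ≤ s) :
    (Measure.pi μ).real {ω | s ≤ ∑ j, f j (ω j)}
      ≤ Real.exp (-(2 * s ^ 2) / ∑ j, (b j - a j) ^ 2) := by
  have hsub (j : ι) : ProbabilityTheory.HasSubgaussianMGF (fun ω : ∀ j, Ω j => f j (ω j))
      ((‖b j - a j‖₊ / 2) ^ 2) (Measure.pi μ) := by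
    have hj := ProbabilityTheory.hasSubgaussianMGF_of_mem_Icc_of_integral_eq_zero
      (hf j).aemeasurable (ae_of_all (μ j) (hab j)) (h0 j)
    rw [← (measurePreserving_eval μ j).map_eq] at hj
    exact hj.of_map (measurePreserving_eval μ j).measurable.aemeasurable
  refine (ProbabilityTheory.HasSubgaussianMGF.measure_sum_ge_le_of_iIndepFun (s := Finset.univ)
    (ProbabilityTheory.iIndepFun_pi fun j => (hf j).aemeasurable)
    (fun j _ => hsub j) hs).trans_eq ?_
  congr 1
  push_cast
  simp only [div_pow, ← Finset.sum_div, Real.norm_eq_abs, sq_abs]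
  ring

lemma measure_pi_abs_sum_ge_le (hf : ∀ j, Measurable (f j))
    (hab : ∀ j x, f j x ∈ Set.Icc (a j) (b j)) (h0 : ∀ j, ∫ x, f j x ∂μ j = 0) {s : ℝ}
    (hs : 0 ≤ s) :
    Measure.pi μ {ω | s ≤ |∑ j, f j (ω j)|}
      ≤ ENNReal.ofReal (2 * Real.exp (-(2 * s ^ 2) / ∑ j, (b j - a j) ^ 2)) := by
  have hpos := measureReal_pi_sum_ge_le hf hab h0 hs
  have hneg := measureReal_pi_sum_ge_le (f := fun j x => -f j x) (a := fun j => -b j)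
    (b := fun j => -a j) (μ := μ) (fun j => (hf j).neg)
    (fun j x => ⟨neg_le_neg (hab j x).2, neg_le_neg (hab j x).1⟩)
    (fun j => by rw [integral_neg, h0 j, neg_zero]) hs
  simp only [neg_sub_neg, Finset.sum_neg_distrib] at hneg
  rw [← ENNReal.ofReal_toReal (measure_ne_top (Measure.pi μ) _)]
  refine ENNReal.ofReal_le_ofReal ?_
  simp only [le_abs, Set.ofPred_or]
  refine (measureReal_union_le _ _).trans ?_
  linarith

end Hoeffding

/-- The law of a fair coin toss, which decides whether two examples of a double sample are
swapped. -/
noncomputable def fairCoin : Measure Bool := (PMF.uniformOfFintype Bool).toMeasure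

instance : IsProbabilityMeasure fairCoin := by
  unfold fairCoin; infer_instance

/-- The sign `±1` attached to a coin toss. -/
def coinSign (b : Bool) : ℝ := if b then 1 else -1

lemma integral_coinSign_mul (c : ℝ) : ∫ b, coinSign b * c ∂fairCoin = 0 := by
  simp [fairCoin, PMF.integral_eq_sum, coinSign]

lemma measure_abs_sum_coinSign_ge_le {ι : Type*} [Fintype ι] {a : ι → ℝ} (ha : ∀ j, |a j| ≤ 1)
    {s : ℝ} (hs : 0 ≤ s) :
    (Measure.pi fun _ => fairCoin) {σ : ι → Bool | s ≤ |∑ j, coinSign (σ j) * a j|}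
      ≤ ENNReal.ofReal (2 * Real.exp (-s ^ 2 / (2 * Fintype.card ι))) := by
  have hmem (j : ι) (b : Bool) : coinSign b * a j ∈ Set.Icc (-1 : ℝ) 1 := by
    have := abs_le.1 (ha j)
    cases b <;> simp [coinSign] <;> constructor <;> linarith
  refine (measure_pi_abs_sum_ge_le (fun _ => measurable_of_countable _) hmem
    (fun j => integral_coinSign_mul (a j)) hs).trans_eq ?_
  congr 3
  simp only [Finset.sum_const, Finset.card_univ, nsmul_eq_mul]
  ring_nf

lemma measure_le_of_forall_measure_preimage_le {S Ω : Type*} [MeasurableSpace S]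
    [MeasurableSpace Ω] (κ : Measure S) [IsProbabilityMeasure κ] {ν : Measure Ω}
    [IsProbabilityMeasure ν] {Φ : S → Ω → Ω} (hΦ : Measurable (Function.uncurry Φ))
    (hν : ∀ σ, MeasurePreserving (Φ σ) ν ν) {A : Set Ω} (hA : MeasurableSet A) {c : ℝ≥0∞}
    (hc : ∀ w, κ {σ | Φ σ w ∈ A} ≤ c) : ν A ≤ c := by
  calc ν A = ∫⁻ σ, ν (Φ σ ⁻¹' A) ∂κ := by
        simp [(hν _).measure_preimage hA.nullMeasurableSet]
    _ = (κ.prod ν) (Function.uncurry Φ ⁻¹' A) := (Measure.prod_apply (hΦ hA)).symm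
    _ = ∫⁻ w, κ {σ | Φ σ w ∈ A} ∂ν := Measure.prod_apply_symm (hΦ hA)
    _ ≤ ∫⁻ _, c ∂ν := lintegral_mono hc
    _ = c := by simp

section Sauer

variable {X : Type*} {H : Finset (X → Bool)}

lemma Shatters.two_pow_card_le {s : Finset X} (hs : Shatters H s) : 2 ^ s.card ≤ H.card := by
  classical
  rw [← Finset.card_powerset]
  refine Finset.card_le_card_of_surjOn (fun h => s.filter fun x => h x = true) fun t ht => ?_
  obtain ⟨h, hh, hst⟩ := hs fun x => decide (x ∈ t)
  refine ⟨h, hh, ?_⟩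
  rw [Finset.mem_coe, Finset.mem_powerset] at ht
  dsimp only
  rw [Finset.filter_congr fun x hx => by rw [hst x hx, decide_eq_true_iff],
    Finset.filter_mem_eq_inter, Finset.inter_eq_right.2 ht]

lemma Shatters.card_le_vcDim {s : Finset X} (hs : Shatters H s) : s.card ≤ vcDim H := by
  refine le_csSup ⟨H.card, ?_⟩ ⟨s, rfl, hs⟩
  rintro k ⟨s, rfl, hs⟩
  exact Nat.lt_two_pow_self.le.trans hs.two_pow_card_le

/-- The family of the traces on the finite set `V` of the hypotheses in `H`, a hypothesis being
identified with the set of points to which it gives the label `true`. -/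
def trace [DecidableEq X] (H : Finset (X → Bool)) (V : Finset X) : Finset (Finset V) :=
  H.image fun h => Finset.univ.filter fun x => h x = true

lemma shatters_of_trace_shatters [DecidableEq X] {V : Finset X} {s : Finset V}
    (hs : (trace H V).Shatters s) : Shatters H (s.map (Function.Embedding.subtype _)) := by
  intro b
  obtain ⟨u, hu, hsu⟩ := hs (Finset.filter_subset (fun x : V => b x = true) s)
  obtain ⟨h, hh, rfl⟩ := Finset.mem_image.1 hu
  refine ⟨h, hh, fun x hx => ?_⟩
  obtain ⟨y, hy, rfl⟩ := Finset.mem_map.1 hx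
  have hmem := congrArg (y ∈ ·) hsu
  simp only [Finset.mem_inter, Finset.mem_filter, hy, Finset.mem_univ, true_and, eq_iff_iff] at hmem
  exact Bool.eq_iff_iff.2 hmem

lemma vcDim_trace_le [DecidableEq X] (H : Finset (X → Bool)) (V : Finset X) :
    (trace H V).vcDim ≤ vcDim H := by
  refine Finset.sup_le fun s hs => ?_
  rw [← s.card_map (Function.Embedding.subtype _)]
  exact (shatters_of_trace_shatters (Finset.mem_shatterer.1 hs)).card_le_vcDim

lemma sum_choose_le_succ_pow (N d : ℕ) : ∑ k ∈ Finset.Iic d, N.choose k ≤ (N + 1) ^ d := by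
  rw [add_pow, ← Nat.range_succ_eq_Iic]
  refine Finset.sum_le_sum fun k hk => ?_
  have hpos : 0 < d.choose k := Nat.choose_pos (Finset.mem_range_succ_iff.1 hk)
  simpa only [one_pow, mul_one, Nat.cast_id] using
    (Nat.choose_le_pow N k).trans (Nat.le_mul_of_pos_right _ hpos)

lemma card_trace_le [DecidableEq X] (H : Finset (X → Bool)) (V : Finset X) :
    (trace H V).card ≤ (V.card + 1) ^ vcDim H :=
  calc (trace H V).card ≤ (trace H V).shatterer.card := Finset.card_le_card_shatterer _
    _ ≤ ∑ k ∈ Finset.Iic (trace H V).vcDim, (Fintype.card V).choose k :=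
        Finset.card_shatterer_le_sum_vcDim
    _ ≤ (V.card + 1) ^ (trace H V).vcDim := by
        simpa only [Fintype.card_coe] using sum_choose_le_succ_pow V.card (trace H V).vcDim
    _ ≤ (V.card + 1) ^ vcDim H := Nat.pow_le_pow_right V.card.succ_pos (vcDim_trace_le H V)

lemma exists_subset_card_le_forall_eqOn (H : Finset (X → Bool)) (V : Finset X) :
    ∃ H' ⊆ H, H'.card ≤ (V.card + 1) ^ vcDim H ∧
      ∀ h ∈ H, ∃ h' ∈ H', Set.EqOn h h' V := by
  classical
  choose! r hrH hr using fun p (hp : p ∈ trace H V) => Finset.mem_image.1 hp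
  refine ⟨(trace H V).image r, Finset.image_subset_iff.2 hrH,
    Finset.card_image_le.trans (card_trace_le H V), fun h hh => ?_⟩
  have hp := Finset.mem_image_of_mem (fun h => Finset.univ.filter fun x : V => h x = true) hh
  refine ⟨_, Finset.mem_image_of_mem r hp, fun x hx => ?_⟩
  have hmem := Finset.ext_iff.1 (hr _ hp) ⟨x, hx⟩
  simp only [Finset.mem_filter, Finset.mem_univ, true_and] at hmem
  exact (Bool.eq_iff_iff.2 hmem).symm

end Sauer

section Loss

variable {X : Type*}

/-- The `0`-`1` loss of the hypothesis `h` on a labeled example. -/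
def loss (h : X → Bool) (z : X × Bool) : ℝ := if h z.1 ≠ z.2 then 1 else 0

lemma loss_mem_Icc (h : X → Bool) (z : X × Bool) : loss h z ∈ Set.Icc (0 : ℝ) 1 := by
  unfold loss; split_ifs <;> norm_num

lemma abs_loss_sub_loss_le_one (h : X → Bool) (z z' : X × Bool) :
    |loss h z - loss h z'| ≤ 1 :=
  abs_sub_le_iff.2 ⟨by linarith [(loss_mem_Icc h z).2, (loss_mem_Icc h z').1],
    by linarith [(loss_mem_Icc h z').2, (loss_mem_Icc h z).1]⟩

lemma natCast_mul_empErr {n : ℕ} (h : X → Bool) (D : Fin n → X × Bool) :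
    n * empErr h D = ∑ j, loss h (D j) := by
  rcases n.eq_zero_or_pos with rfl | hn
  · simp
  · simp only [empErr, loss, Finset.sum_boole]
    field_simp

variable [MeasurableSpace X] {h : X → Bool}

lemma measurableSet_misclassified (hh : Measurable h) :
    MeasurableSet {z : X × Bool | h z.1 ≠ z.2} :=
  (measurableSet_eq_fun (hh.comp measurable_fst) measurable_snd).compl

@[fun_prop]
lemma measurable_loss (hh : Measurable h) : Measurable (loss h) :=
  Measurable.ite (measurableSet_misclassified hh) measurable_const measurable_const

lemma integral_loss (P : Measure (X × Bool)) (hh : Measurable h) :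
    ∫ z, loss h z ∂P = err P h := by
  have hind : loss h = {z : X × Bool | h z.1 ≠ z.2}.indicator 1 := by
    ext z; simp [loss, Set.indicator_apply]
  rw [hind, integral_indicator_one (measurableSet_misclassified hh), err]

@[fun_prop]
lemma measurable_empErr {n : ℕ} (hh : Measurable h) :
    Measurable fun D : Fin n → X × Bool => empErr h D := by
  have heq : (fun D : Fin n → X × Bool => empErr h D) = fun D => (∑ j, loss h (D j)) / n := by
    simp only [empErr, loss, Finset.sum_boole]
  rw [heq]
  fun_prop

lemma measure_abs_empErr_sub_err_ge_le (P : Measure (X × Bool)) [IsProbabilityMeasure P]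
    (hh : Measurable h) (n : ℕ) {ε : ℝ} (hε : 0 ≤ ε) :
    (Measure.pi fun _ : Fin n => P) {D | ε ≤ |empErr h D - err P h|}
      ≤ ENNReal.ofReal (2 * Real.exp (-(2 * n * ε ^ 2))) := by
  have hmean : ∫ z, (loss h z - err P h) ∂P = 0 := by
    have hint : Integrable (loss h) P := .of_mem_Icc 0 1 (measurable_loss hh).aemeasurable
      (ae_of_all _ (loss_mem_Icc h))
    rw [integral_sub hint (integrable_const _), integral_loss P hh, integral_const,
      probReal_univ, one_smul, sub_self]
  have hmem (z : X × Bool) : loss h z - err P h ∈ Set.Icc (-err P h) (1 - err P h) :=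
    ⟨by linarith [(loss_mem_Icc h z).1], by linarith [(loss_mem_Icc h z).2]⟩
  have hsum (D : Fin n → X × Bool) :
      ∑ j, (loss h (D j) - err P h) = n * (empErr h D - err P h) := by
    rw [Finset.sum_sub_distrib, ← natCast_mul_empErr, Finset.sum_const, Finset.card_univ,
      Fintype.card_fin, nsmul_eq_mul, mul_sub]
  calc (Measure.pi fun _ : Fin n => P) {D | ε ≤ |empErr h D - err P h|}
      ≤ (Measure.pi fun _ : Fin n => P) {D | n * ε ≤ |∑ j, (loss h (D j) - err P h)|} := by
        refine measure_mono fun D hD => ?_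
        rw [Set.mem_ofPred_eq, hsum, abs_mul, Nat.abs_cast]
        exact mul_le_mul_of_nonneg_left hD n.cast_nonneg
    _ ≤ ENNReal.ofReal (2 * Real.exp (-(2 * (n * ε) ^ 2) /
          ∑ _j : Fin n, (1 - err P h - -err P h) ^ 2)) :=
        measure_pi_abs_sum_ge_le (fun _ => (measurable_loss hh).sub_const _) (fun _ => hmem)
          (fun _ => hmean) (by positivity)
    _ = ENNReal.ofReal (2 * Real.exp (-(2 * n * ε ^ 2))) := by
        congr 3
        rcases n.eq_zero_or_pos with rfl | hn
        · simp
        · simp only [sub_neg_eq_add, sub_add_cancel, one_pow, Finset.sum_const, Finset.card_univ,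
            Fintype.card_fin, nsmul_eq_mul, mul_one]
          field_simp

end Loss

section VapnikChervonenkis

variable {X : Type*}

lemma measure_swaps_le (H : Finset (X → Bool)) {n : ℕ} (w : Fin n → (X × Bool) × (X × Bool))
    {s : ℝ} (hs : 0 ≤ s) :
    (Measure.pi fun _ => fairCoin) {σ : Fin n → Bool |
        ∃ h ∈ H, s < |∑ j, coinSign (σ j) * (loss h (w j).1 - loss h (w j).2)|}
      ≤ ENNReal.ofReal ((2 * n + 1) ^ vcDim H * (2 * Real.exp (-s ^ 2 / (2 * n)))) := by
  classical
  let V : Finset X := Finset.univ.image (fun j => (w j).1.1) ∪ Finset.univ.image fun j => (w j).2.1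
  have hVcard : V.card ≤ 2 * n := by
    refine (Finset.card_union_le _ _).trans ((add_le_add Finset.card_image_le
      Finset.card_image_le).trans ?_)
    simp [two_mul]
  obtain ⟨H', -, hcard, hrep⟩ := exists_subset_card_le_forall_eqOn H V
  have hsub : {σ : Fin n → Bool |
      ∃ h ∈ H, s < |∑ j, coinSign (σ j) * (loss h (w j).1 - loss h (w j).2)|} ⊆
      ⋃ h ∈ H', {σ | s ≤ |∑ j, coinSign (σ j) * (loss h (w j).1 - loss h (w j).2)|} := by
    rintro σ ⟨h, hh, hlt⟩
    obtain ⟨h', hh', heq⟩ := hrep h hh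
    have hfst (j : Fin n) : loss h (w j).1 = loss h' (w j).1 := by
      rw [loss, loss, heq (by simp [V])]
    have hsnd (j : Fin n) : loss h (w j).2 = loss h' (w j).2 := by
      rw [loss, loss, heq (by simp [V])]
    simp only [hfst, hsnd] at hlt
    exact Set.mem_biUnion hh' hlt.le
  have hH' : (H'.card : ℝ) ≤ (2 * n + 1) ^ vcDim H := by
    exact_mod_cast hcard.trans (Nat.pow_le_pow_left (Nat.add_le_add_right hVcard 1) _)
  refine (measure_mono hsub).trans ((measure_biUnion_finset_le _ _).trans ?_)
  refine (Finset.sum_le_card_nsmul H' _ _ fun h _ => measure_abs_sum_coinSign_ge_le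
    (fun j => abs_loss_sub_loss_le_one h (w j).1 (w j).2) hs).trans ?_
  rw [← ENNReal.ofReal_nsmul, nsmul_eq_mul, Fintype.card_fin]
  gcongr

variable [MeasurableSpace X] (P : Measure (X × Bool)) {H : Finset (X → Bool)}

lemma measurableSet_exists_lt_abs_sum_loss_sub (hm : ∀ h ∈ H, Measurable h) (n : ℕ) (s : ℝ) :
    MeasurableSet {q : (Fin n → X × Bool) × (Fin n → X × Bool) |
      ∃ h ∈ H, s < |∑ j, (loss h (q.1 j) - loss h (q.2 j))|} := by
  simp only [← exists_prop, Set.ofPred_exists]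
  refine Finset.measurableSet_biUnion _ fun h hh => ?_
  have := hm h hh
  exact measurableSet_lt measurable_const (by fun_prop)

lemma measurableSet_exists_lt_abs_empErr_sub_err (hm : ∀ h ∈ H, Measurable h) (n : ℕ) (ε : ℝ) :
    MeasurableSet {D : Fin n → X × Bool | ∃ h ∈ H, ε < |empErr h D - err P h|} := by
  simp only [← exists_prop, Set.ofPred_exists]
  refine Finset.measurableSet_biUnion _ fun h hh => ?_
  have := hm h hh
  exact measurableSet_lt measurable_const (by fun_prop)

variable [IsProbabilityMeasure P]

lemma measure_double_sample_le (hm : ∀ h ∈ H, Measurable h) {n : ℕ} {s : ℝ} (hs : 0 ≤ s) :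
    (Measure.pi fun _ : Fin n => P.prod P)
      {w | ∃ h ∈ H, s < |∑ j, (loss h (w j).1 - loss h (w j).2)|}
      ≤ ENNReal.ofReal ((2 * n + 1) ^ vcDim H * (2 * Real.exp (-s ^ 2 / (2 * n)))) := by
  let swap (b : Bool) : (X × Bool) × (X × Bool) → (X × Bool) × (X × Bool) :=
    if b then id else Prod.swap
  have hswap (b : Bool) : MeasurePreserving (swap b) (P.prod P) (P.prod P) := by
    cases b
    · exact Measure.measurePreserving_swap
    · exact MeasurePreserving.id _
  have hloss (h : X → Bool) (b : Bool) (z) :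
      loss h (swap b z).1 - loss h (swap b z).2 = coinSign b * (loss h z.1 - loss h z.2) := by
    cases b <;> simp [swap, coinSign]
  have hpi (σ : Fin n → Bool) := measurePreserving_pi _ _ fun j => hswap (σ j)
  refine measure_le_of_forall_measure_preimage_le (Measure.pi fun _ => fairCoin)
    (Φ := fun σ (w : Fin n → (X × Bool) × (X × Bool)) j => swap (σ j) (w j))
    (measurable_from_prod_countable_right fun σ => (hpi σ).measurable) hpi ?_ fun w => ?_
  · simp only [← exists_prop, Set.ofPred_exists]
    refine Finset.measurableSet_biUnion _ fun h hh => ?_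
    have := hm h hh
    exact measurableSet_lt measurable_const (by fun_prop)
  · simp only [Set.mem_ofPred_eq, hloss]
    exact measure_swaps_le H w hs

lemma measure_ghost_sample_le (hm : ∀ h ∈ H, Measurable h) {n : ℕ} {s : ℝ} (hs : 0 ≤ s) :
    ((Measure.pi fun _ : Fin n => P).prod (Measure.pi fun _ : Fin n => P))
      {q | ∃ h ∈ H, s < |∑ j, (loss h (q.1 j) - loss h (q.2 j))|}
      ≤ ENNReal.ofReal ((2 * n + 1) ^ vcDim H * (2 * Real.exp (-s ^ 2 / (2 * n)))) := by
  rw [← (measurePreserving_arrowProdEquivProdArrow (X × Bool) (X × Bool) (Fin n)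
    (fun _ => P) fun _ => P).measure_preimage_equiv]
  exact measure_double_sample_le P hm hs

lemma one_half_le_measure_abs_empErr_sub_err_lt {h : X → Bool} (hh : Measurable h) {n : ℕ} {ε : ℝ}
    (hε : 0 ≤ ε) (hnε : 4 ≤ n * ε ^ 2) :
    ENNReal.ofReal (1 / 2) ≤
      (Measure.pi fun _ : Fin n => P) {D | |empErr h D - err P h| < ε / 2} := by
  have hexp : 2 * Real.exp (-(2 * n * (ε / 2) ^ 2)) ≤ 1 / 2 := by
    have hquad := Real.quadratic_le_exp_of_nonneg (zero_le_two : (0 : ℝ) ≤ 2)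
    calc 2 * Real.exp (-(2 * n * (ε / 2) ^ 2)) ≤ 2 * Real.exp (-2) := by
          gcongr; linarith
      _ ≤ 1 / 2 := by
          rw [Real.exp_neg, ← div_eq_mul_inv, div_le_iff₀ (Real.exp_pos 2)]; linarith
  have hcompl : {D : Fin n → X × Bool | |empErr h D - err P h| < ε / 2}
      = {D | ε / 2 ≤ |empErr h D - err P h|}ᶜ := by
    ext D; simp
  have hmeas : MeasurableSet {D : Fin n → X × Bool | ε / 2 ≤ |empErr h D - err P h|} :=
    measurableSet_le measurable_const (by fun_prop)
  rw [hcompl, prob_compl_eq_one_sub hmeas]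
  calc ENNReal.ofReal (1 / 2) = 1 - ENNReal.ofReal (1 / 2) := by
        rw [← ENNReal.ofReal_one, ← ENNReal.ofReal_sub _ (by norm_num)]; norm_num
    _ ≤ _ := tsub_le_tsub_left ((measure_abs_empErr_sub_err_ge_le P hh n (by positivity)).trans
        (ENNReal.ofReal_le_ofReal hexp)) 1

lemma measure_exists_deviation_le_two_mul (hm : ∀ h ∈ H, Measurable h) {n : ℕ} {ε : ℝ}
    (hε : 0 ≤ ε) (hnε : 4 ≤ n * ε ^ 2) :
    (Measure.pi fun _ : Fin n => P) {D | ∃ h ∈ H, ε < |empErr h D - err P h|}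
      ≤ 2 * ((Measure.pi fun _ : Fin n => P).prod (Measure.pi fun _ : Fin n => P))
        {q | ∃ h ∈ H, n * ε / 2 < |∑ j, (loss h (q.1 j) - loss h (q.2 j))|} := by
  set μ := Measure.pi fun _ : Fin n => P
  set A := {D : Fin n → X × Bool | ∃ h ∈ H, ε < |empErr h D - err P h|}
  set S := {q : (Fin n → X × Bool) × (Fin n → X × Bool) |
    ∃ h ∈ H, n * ε / 2 < |∑ j, (loss h (q.1 j) - loss h (q.2 j))|}
  have hn : (0 : ℝ) < n := by
    rcases n.eq_zero_or_pos with rfl | hn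
    · norm_num at hnε
    · exact_mod_cast hn
  have hsec (D) (hD : D ∈ A) : ENNReal.ofReal (1 / 2) ≤ μ (Prod.mk D ⁻¹' S) := by
    obtain ⟨h, hh, hD⟩ := hD
    refine (one_half_le_measure_abs_empErr_sub_err_lt P (hm h hh) hε hnε).trans
      (measure_mono fun D' hD' => ⟨h, hh, ?_⟩)
    have hsum : ∑ j, (loss h (D j) - loss h (D' j))
        = n * ((empErr h D - err P h) - (empErr h D' - err P h)) := by
      rw [Finset.sum_sub_distrib, ← natCast_mul_empErr, ← natCast_mul_empErr]; ring
    have htri := abs_sub_abs_le_abs_sub (empErr h D - err P h) (empErr h D' - err P h)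
    rw [Set.mem_ofPred_eq] at hD'
    simp only [hsum, abs_mul, Nat.abs_cast, mul_div_assoc]
    exact mul_lt_mul_of_pos_left (by linarith) hn
  have hhalf : ENNReal.ofReal (1 / 2) * μ A ≤ (μ.prod μ) S := by
    rw [Measure.prod_apply (measurableSet_exists_lt_abs_sum_loss_sub hm n _), ← setLIntegral_const]
    exact (setLIntegral_mono' (measurableSet_exists_lt_abs_empErr_sub_err P hm n ε) hsec).trans
      (setLIntegral_le_lintegral _ _)
  calc μ A = 2 * (ENNReal.ofReal (1 / 2) * μ A) := by
        rw [← mul_assoc, ← ENNReal.ofReal_ofNat 2, ← ENNReal.ofReal_mul (by norm_num)]; norm_num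
    _ ≤ 2 * (μ.prod μ) S := by gcongr

lemma measure_exists_deviation_le (hm : ∀ h ∈ H, Measurable h) (n : ℕ) {ε : ℝ} (hε : 0 ≤ ε) :
    (Measure.pi fun _ : Fin n => P) {D | ∃ h ∈ H, ε < |empErr h D - err P h|}
      ≤ ENNReal.ofReal (4 * (2 * n + 1) ^ vcDim H * Real.exp (-(n * ε ^ 2 / 8))) := by
  rcases le_or_gt 4 (n * ε ^ 2) with hnε | hnε
  · refine (measure_exists_deviation_le_two_mul P hm hε hnε).trans
      ((mul_le_mul_right (measure_ghost_sample_le P hm (by positivity)) 2).trans_eq ?_)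
    rw [← ENNReal.ofReal_ofNat 2, ← ENNReal.ofReal_mul (by norm_num)]
    have hexponent : -(n * ε / 2) ^ 2 / (2 * n) = -(n * ε ^ 2 / 8) := by
      rcases eq_or_ne (n : ℝ) 0 with hn | hn
      · simp [hn]
      · field_simp; ring
    rw [hexponent]
    ring_nf
  · refine prob_le_one.trans (ENNReal.one_le_ofReal.2 ?_)
    have hpow : (1 : ℝ) ≤ (2 * n + 1) ^ vcDim H :=
      one_le_pow₀ (by linarith [n.cast_nonneg (α := ℝ)])
    have hexp := Real.one_sub_le_exp_neg (n * ε ^ 2 / 8)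
    nlinarith

end VapnikChervonenkis

section UniformConvergence

variable {d n : ℕ} {δ₀ : ℝ}

lemma one_lt_div_of_le_of_lt_one (hn : 1 ≤ n) (h0 : 0 < δ₀) (h1 : δ₀ < 1) : 1 < (n : ℝ) / δ₀ :=
  (one_lt_div h0).2 (h1.trans_le (Nat.one_le_cast.2 hn))

lemma rate_pos (hd : 1 ≤ d) (hn : 1 ≤ n) (h0 : 0 < δ₀) (h1 : δ₀ < 1) : 0 < rate d n δ₀ := by
  have hlog := Real.log_pos (one_lt_div_of_le_of_lt_one hn h0 h1)
  unfold rate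
  positivity

lemma natCast_mul_rate_sq (hn : 1 ≤ n) (h0 : 0 < δ₀) (h1 : δ₀ < 1) :
    n * rate d n δ₀ ^ 2 = d * Real.log (n / δ₀) := by
  have hlog := Real.log_pos (one_lt_div_of_le_of_lt_one hn h0 h1)
  rw [rate, Real.sq_sqrt (by positivity)]
  field_simp

lemma four_mul_pow_mul_exp_le (hd : 1 ≤ d) (hn : 2 ≤ n) (h0 : 0 < δ₀) (h1 : δ₀ ≤ 1) :
    4 * (2 * n + 1) ^ d * Real.exp (-(8 * (d * Real.log (n / δ₀)))) ≤ δ₀ := by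
  have hn2 : (2 : ℝ) ≤ n := by exact_mod_cast hn
  have hexp : Real.exp (-(8 * (d * Real.log (n / δ₀)))) = ((δ₀ / n) ^ 8) ^ d := by
    rw [← inv_div (n : ℝ) δ₀, inv_pow, inv_pow, Real.exp_neg, inv_inj, ← pow_mul,
      ← Real.exp_log (x := (n / δ₀) ^ (8 * d)) (by positivity), Real.log_pow]
    push_cast
    ring_nf
  have hbase : 4 * (2 * n + 1) * (δ₀ / n) ^ 8 ≤ δ₀ := by
    rw [div_pow, mul_div_assoc', div_le_iff₀ (by positivity), mul_comm δ₀]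
    have hpow : (2 : ℝ) ^ 7 ≤ n ^ 7 := pow_le_pow_left₀ zero_le_two hn2 7
    exact mul_le_mul (by nlinarith) (pow_le_of_le_one h0.le h1 (by norm_num)) (by positivity)
      (by positivity)
  calc 4 * (2 * n + 1) ^ d * Real.exp (-(8 * (d * Real.log (n / δ₀))))
      ≤ 4 ^ d * (2 * n + 1) ^ d * ((δ₀ / n) ^ 8) ^ d := by
        rw [hexp]
        gcongr
        exact le_self_pow₀ (by norm_num) (by omega)
    _ = (4 * (2 * n + 1) * (δ₀ / n) ^ 8) ^ d := by rw [mul_pow, mul_pow]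
    _ ≤ δ₀ ^ d := pow_le_pow_left₀ (by positivity) hbase d
    _ ≤ δ₀ := pow_le_of_le_one h0.le h1 (by omega)

variable {X : Type*} [MeasurableSpace X] (P : Measure (X × Bool)) {H : Finset (X → Bool)}

lemma measurableSet_forall_abs_empErr_sub_err_le (hm : ∀ h ∈ H, Measurable h) (n : ℕ) (c : ℝ) :
    MeasurableSet {D : Fin n → X × Bool | ∀ h ∈ H, |empErr h D - err P h| ≤ c} := by
  convert (measurableSet_exists_lt_abs_empErr_sub_err P hm n c).compl using 1
  ext D
  simp

variable [IsProbabilityMeasure P]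

lemma le_measure_forall_deviation_le_eight_mul_rate (hm : ∀ h ∈ H, Measurable h)
    (hH : vcDim H ≤ d) (hd : 1 ≤ d) (hn : 2 ≤ n) (h0 : 0 < δ₀) (h1 : δ₀ < 1) :
    ENNReal.ofReal (1 - δ₀) ≤ (Measure.pi fun _ : Fin n => P)
      {D | ∀ h ∈ H, |empErr h D - err P h| ≤ 8 * rate d n δ₀} := by
  have hexponent : n * (8 * rate d n δ₀) ^ 2 / 8 = 8 * (d * Real.log (n / δ₀)) := by
    rw [← natCast_mul_rate_sq (by omega) h0 h1]; ring
  have hpow : ((2 * n + 1 : ℝ)) ^ vcDim H ≤ (2 * n + 1) ^ d :=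
    pow_le_pow_right₀ (by linarith [n.cast_nonneg (α := ℝ)]) hH
  have hfail : (Measure.pi fun _ : Fin n => P)
      {D | ∃ h ∈ H, 8 * rate d n δ₀ < |empErr h D - err P h|} ≤ ENNReal.ofReal δ₀ := by
    refine (measure_exists_deviation_le P hm n
      (mul_nonneg (by norm_num) (rate_pos hd (by omega) h0 h1).le)).trans
      (ENNReal.ofReal_le_ofReal ?_)
    rw [hexponent]
    refine le_trans ?_ (four_mul_pow_mul_exp_le hd hn h0 h1.le)
    gcongr
  have hcompl : {D : Fin n → X × Bool | ∀ h ∈ H, |empErr h D - err P h| ≤ 8 * rate d n δ₀}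
      = {D | ∃ h ∈ H, 8 * rate d n δ₀ < |empErr h D - err P h|}ᶜ := by
    ext D; simp
  rw [hcompl, prob_compl_eq_one_sub (measurableSet_exists_lt_abs_empErr_sub_err P hm n _),
    ENNReal.ofReal_sub _ h0.le, ENNReal.ofReal_one]
  exact tsub_le_tsub_left hfail 1

lemma ucConstant_le_eight (hm : ∀ h ∈ H, Measurable h)
    (hH : vcDim H ≤ d) (hd : 1 ≤ d) (hn : 2 ≤ n) (h0 : 0 < δ₀) (h1 : δ₀ < 1) :
    ucConstant P H d n δ₀ ≤ 8 :=
  csInf_le ⟨0, fun _ hc => hc.1.le⟩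
    ⟨by norm_num, le_measure_forall_deviation_le_eight_mul_rate P hm hH hd hn h0 h1⟩

lemma le_measure_forall_deviation_le_ucConstant_mul_rate (hm : ∀ h ∈ H, Measurable h)
    (hH : vcDim H ≤ d) (hd : 1 ≤ d) (hn : 2 ≤ n) (h0 : 0 < δ₀) (h1 : δ₀ < 1) :
    ENNReal.ofReal (1 - δ₀) ≤ (Measure.pi fun _ : Fin n => P)
      {D | ∀ h ∈ H, |empErr h D - err P h| ≤ ucConstant P H d n δ₀ * rate d n δ₀} := by
  set μ := Measure.pi fun _ : Fin n => P
  let E (c : ℝ) : Set (Fin n → X × Bool) :=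
    {D | ∀ h ∈ H, |empErr h D - err P h| ≤ c * rate d n δ₀}
  have hρ : 0 < rate d n δ₀ := rate_pos hd (by omega) h0 h1
  have hmono : Monotone E := fun c c' hcc' D hD h hh =>
    (hD h hh).trans (mul_le_mul_of_nonneg_right hcc' hρ.le)
  have hE (c : ℝ) (hc : ucConstant P H d n δ₀ < c) : ENNReal.ofReal (1 - δ₀) ≤ μ (E c) := by
    obtain ⟨c', ⟨-, hc'⟩, hlt⟩ := exists_lt_of_csInf_lt
      (by exact ⟨8, by norm_num,
        le_measure_forall_deviation_le_eight_mul_rate P hm hH hd hn h0 h1⟩) hc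
    exact hc'.trans (measure_mono (hmono hlt.le))
  have hlim := tendsto_measure_biInter_gt (μ := μ) (s := E) (a := ucConstant P H d n δ₀)
    (fun c _ => (measurableSet_forall_abs_empErr_sub_err_le P hm n _).nullMeasurableSet)
    (fun _ _ _ hij => hmono hij) ⟨_, lt_add_one _, measure_ne_top _ _⟩
  refine (ge_of_tendsto hlim (Filter.eventually_of_mem self_mem_nhdsWithin hE)).trans
    (measure_mono fun D hD h hh => ?_)
  rw [← div_le_iff₀ hρ]
  refine le_of_forall_gt_imp_ge_of_dense fun c hc => (div_le_iff₀ hρ).2 ?_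
  exact Set.mem_iInter₂.1 hD c hc h hh

end UniformConvergence

section Laplace

variable {b s : ℝ}

lemma laplace_apply_of_eqOn {A : Set ℝ} (hA : MeasurableSet A) {g : ℝ → ℝ}
    (hg : Set.EqOn (fun x => Real.exp (-|x| / b)) g A) (hb : 0 < b) (hint : IntegrableOn g A) :
    laplace b A = ENNReal.ofReal ((2 * b)⁻¹ * ∫ x in A, g x) := by
  have hnonneg : ∀ x ∈ A, 0 ≤ (2 * b)⁻¹ * g x := fun x hx => by
    rw [← hg hx]; positivity
  rw [laplace, withDensity_apply _ hA, ← integral_const_mul,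
    ofReal_integral_eq_lintegral_ofReal (hint.const_mul _)
      ((ae_restrict_iff' hA).2 (Filter.Eventually.of_forall hnonneg))]
  exact setLIntegral_congr_fun hA fun x hx => congrArg (fun y => ENNReal.ofReal (_ * y)) (hg hx)

lemma laplace_Ioi (hb : 0 < b) (hs : 0 ≤ s) :
    laplace b (Set.Ioi s) = ENNReal.ofReal (Real.exp (-(s / b)) / 2) := by
  have hslope : -b⁻¹ < 0 := neg_neg_of_pos (inv_pos.2 hb)
  rw [laplace_apply_of_eqOn measurableSet_Ioi (g := fun x => Real.exp (-b⁻¹ * x)) ?_ hb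
    (integrableOn_exp_mul_Ioi hslope s), integral_exp_mul_Ioi hslope s]
  · rw [show -b⁻¹ * s = -(s / b) by ring]
    field_simp
  · intro x hx
    simp only [abs_of_pos (hs.trans_lt hx)]
    ring_nf

lemma laplace_Iic_neg (hb : 0 < b) (hs : 0 ≤ s) :
    laplace b (Set.Iic (-s)) = ENNReal.ofReal (Real.exp (-(s / b)) / 2) := by
  have hslope : 0 < b⁻¹ := inv_pos.2 hb
  rw [laplace_apply_of_eqOn measurableSet_Iic (g := fun x => Real.exp (b⁻¹ * x)) ?_ hb
    (integrableOn_exp_mul_Iic hslope (-s)), integral_exp_mul_Iic hslope (-s)]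
  · rw [show b⁻¹ * -s = -(s / b) by ring]
    field_simp
  · intro x hx
    simp only [abs_of_nonpos (le_trans hx (neg_nonpos.2 hs))]
    ring_nf

lemma isProbabilityMeasure_laplace (hb : 0 < b) : IsProbabilityMeasure (laplace b) := by
  have hIic := laplace_Iic_neg hb le_rfl
  rw [neg_zero] at hIic
  constructor
  rw [← Set.Iic_union_Ioi (a := (0 : ℝ)),
    measure_union (Set.Iic_disjoint_Ioi le_rfl) measurableSet_Ioi, hIic, laplace_Ioi hb le_rfl,
    ← ENNReal.ofReal_add (by positivity) (by positivity)]
  norm_num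

lemma laplace_Iic (hb : 0 < b) (hs : 0 ≤ s) :
    laplace b (Set.Iic s) = ENNReal.ofReal (1 - Real.exp (-(s / b)) / 2) := by
  have := isProbabilityMeasure_laplace hb
  rw [← Set.compl_Ioi, prob_compl_eq_one_sub measurableSet_Ioi, laplace_Ioi hb hs,
    ENNReal.ofReal_sub _ (by positivity), ENNReal.ofReal_one]

lemma laplace_Ioi_neg (hb : 0 < b) (hs : 0 ≤ s) :
    laplace b (Set.Ioi (-s)) = ENNReal.ofReal (1 - Real.exp (-(s / b)) / 2) := by
  have := isProbabilityMeasure_laplace hb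
  rw [← Set.compl_Iic, prob_compl_eq_one_sub measurableSet_Iic, laplace_Iic_neg hb hs,
    ENNReal.ofReal_sub _ (by positivity), ENNReal.ofReal_one]

lemma isProbabilityMeasure_lmmNoise {α : ℝ} (hα : 0 < α) (K : ℕ) :
    IsProbabilityMeasure (lmmNoise α K) := by
  have := isProbabilityMeasure_laplace (b := 3 / α) (by positivity)
  have := isProbabilityMeasure_laplace (b := 6 / α) (by positivity)
  have := isProbabilityMeasure_laplace (b := 12 / α) (by positivity)
  unfold lmmNoise
  infer_instance

lemma lmmNoise_prod_prod_preimage_eval {α : ℝ} (hα : 0 < α) {K : ℕ} (r : Fin (K - 1))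
    (A B : Set ℝ) {T : Set ℝ} (hT : MeasurableSet T) :
    lmmNoise α K (A ×ˢ B ×ˢ (Function.eval r ⁻¹' T))
      = laplace (3 / α) A * (laplace (6 / α) B * laplace (12 / α) T) := by
  have := isProbabilityMeasure_laplace (b := 6 / α) (by positivity)
  have := isProbabilityMeasure_laplace (b := 12 / α) (by positivity)
  rw [lmmNoise, Measure.prod_prod, Measure.prod_prod,
    (measurePreserving_eval (fun _ : Fin (K - 1) => laplace (12 / α)) r).measure_preimage
      hT.nullMeasurableSet]

end Laplace

section Rank

variable {ι : Type*} {H : Finset ι} {f : ι → ℝ}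

lemma bddAbove_setOf_le_card_filter {ℓ : ℕ} (hℓ : 1 ≤ ℓ) :
    BddAbove {v : ℝ | ℓ ≤ (H.filter fun i => v ≤ f i).card} := by
  refine ⟨∑ i ∈ H, |f i|, fun v hv => ?_⟩
  obtain ⟨i, hi⟩ := Finset.card_pos.1 (hℓ.trans hv)
  obtain ⟨hiH, hvi⟩ := Finset.mem_filter.1 hi
  exact hvi.trans ((le_abs_self _).trans
    (Finset.single_le_sum (f := fun i => |f i|) (fun _ _ => abs_nonneg _) hiH))

lemma le_kthHighest_one {i : ι} (hi : i ∈ H) : f i ≤ kthHighest H f 1 :=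
  le_csSup (bddAbove_setOf_le_card_filter le_rfl)
    (Finset.card_pos.2 ⟨i, Finset.mem_filter.2 ⟨hi, le_rfl⟩⟩)

lemma kthHighest_le_of_forall_notMem {ℓ : ℕ} (hℓ : ℓ ≤ H.card) {T : Finset ι} (hT : T.card < ℓ)
    {v : ℝ} (hv : ∀ i ∈ H, i ∉ T → f i ≤ v) : kthHighest H f ℓ ≤ v := by
  refine csSup_le ⟨-∑ i ∈ H, |f i|, ?_⟩ fun u hu => ?_
  · have hall : (H.filter fun i => -∑ i ∈ H, |f i| ≤ f i) = H :=
      Finset.filter_true_of_mem fun i hi => neg_le.1 <| (neg_le_abs _).trans <|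
        Finset.single_le_sum (f := fun i => |f i|) (fun _ _ => abs_nonneg _) hi
    simpa [hall] using hℓ
  · obtain ⟨i, hi, hiT⟩ := Finset.exists_mem_notMem_of_card_lt_card (hT.trans_le hu)
    obtain ⟨hiH, hui⟩ := Finset.mem_filter.1 hi
    exact hui.trans (hv i hiH hiT)

variable {n : ℕ} {α δ Z G : ℝ} {Zs : Fin (H.card - 1) → ℝ}

lemma lmmRank_le_iff {m : ℕ} : lmmRank n α δ H f Z G Zs ≤ m ↔ H.card ≤ m ∨
    ∃ r : Fin (H.card - 1), (r : ℕ) + 1 ≤ m ∧ (Zs r + G) / n + bigThreshold n α δ (r + 1) <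
      (kthHighest H f 1 + Z / n) - kthHighest H f (r + 1 + 1) := by
  constructor
  · intro h
    rcases Nat.sInf_mem (s := {H.card} ∪ {ℓ : ℕ | ∃ r : Fin (H.card - 1), ℓ = (r : ℕ) + 1 ∧
      (kthHighest H f 1 + Z / n) - kthHighest H f (ℓ + 1) > (Zs r + G) / n + bigThreshold n α δ ℓ})
      ⟨H.card, Or.inl rfl⟩ with hcard | ⟨r, hr, htest⟩
    · exact Or.inl (le_of_eq_of_le hcard.symm h)
    · rw [hr] at htest
      exact Or.inr ⟨r, le_of_eq_of_le hr.symm h, htest⟩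
  · rintro (h | ⟨r, hrm, hr⟩)
    · exact (Nat.sInf_le (Or.inl rfl)).trans h
    · exact (Nat.sInf_le (Or.inr ⟨r, rfl, hr⟩)).trans hrm

lemma lmmRank_le_card : lmmRank n α δ H f Z G Zs ≤ H.card :=
  lmmRank_le_iff.2 (Or.inl le_rfl)

lemma one_le_lmmRank (hH : H.Nonempty) : 1 ≤ lmmRank n α δ H f Z G Zs := by
  refine Nat.one_le_iff_ne_zero.2 fun h => ?_
  rcases lmmRank_le_iff.1 h.le with hcard | ⟨r, hr, -⟩
  · exact hH.card_pos.not_ge hcard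
  · omega

variable (H f n α δ)

lemma measurableSet_lmmRank_le (m : ℕ) : MeasurableSet
    {w : ℝ × ℝ × (Fin (H.card - 1) → ℝ) | lmmRank n α δ H f w.1 w.2.1 w.2.2 ≤ m} := by
  simp only [lmmRank_le_iff, Set.ofPred_or, Set.ofPred_exists, Set.ofPred_and]
  exact (MeasurableSet.const _).union (MeasurableSet.iUnion fun r =>
    (MeasurableSet.const _).inter (measurableSet_lt (by fun_prop) (by fun_prop)))

variable {H f n α δ}

lemma laplace_mul_le_lmmNoise_lmmRank_le (hn : 0 < n) (hα : 0 < α) {m : ℕ} (hm : 1 ≤ m)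
    {z g y : ℝ} (hgap : m < H.card → (y + g) / n + bigThreshold n α δ m ≤
      (kthHighest H f 1 + z / n) - kthHighest H f (m + 1)) :
    laplace (3 / α) (Set.Ioi z) * (laplace (6 / α) (Set.Iic g) * laplace (12 / α) (Set.Iic y)) ≤
      lmmNoise α H.card {w | lmmRank n α δ H f w.1 w.2.1 w.2.2 ≤ m} := by
  have := isProbabilityMeasure_lmmNoise hα H.card
  have := isProbabilityMeasure_laplace (b := 3 / α) (by positivity)
  have := isProbabilityMeasure_laplace (b := 6 / α) (by positivity)
  have := isProbabilityMeasure_laplace (b := 12 / α) (by positivity)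
  rcases le_or_gt H.card m with hcard | hcard
  · simp only [lmmRank_le_card.trans hcard, Set.ofPred_true, measure_univ]
    exact mul_le_one' prob_le_one (mul_le_one' prob_le_one prob_le_one)
  · let r : Fin (H.card - 1) := ⟨m - 1, by omega⟩
    have hr : (r : ℕ) + 1 = m := Nat.sub_add_cancel hm
    rw [← lmmNoise_prod_prod_preimage_eval hα r _ _ measurableSet_Iic]
    refine measure_mono ?_
    rintro ⟨Z, G, Zs⟩ ⟨hZ : z < Z, hG : G ≤ g, hZs : Zs r ≤ y⟩
    refine lmmRank_le_iff.2 (Or.inr ⟨r, hr.le, ?_⟩)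
    rw [hr]
    calc (Zs r + G) / n + bigThreshold n α δ m ≤ (y + g) / n + bigThreshold n α δ m := by gcongr
      _ ≤ kthHighest H f 1 + z / n - kthHighest H f (m + 1) := hgap hcard
      _ < kthHighest H f 1 + Z / n - kthHighest H f (m + 1) := by gcongr

end Rank

section ExponentialMechanism

variable {ι : Type*} {H U : Finset ι} {f : ι → ℝ} {β : ℝ}

lemma IsTopSet.exists_mem_forall_le {ℓ : ℕ} (hU : IsTopSet H f ℓ U) (hℓ : 1 ≤ ℓ) :
    ∃ i ∈ U, ∀ j ∈ H, f j ≤ f i := by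
  obtain ⟨-, hcard, htop⟩ := hU
  obtain ⟨i, hi, hmax⟩ := Finset.exists_max_image U f (Finset.card_pos.1 (by omega))
  exact ⟨i, hi, fun j hj => (em (j ∈ U)).elim (hmax j) (htop i hi j hj)⟩

lemma expMech_nonneg (i : ι) : 0 ≤ expMech β f U i :=
  div_nonneg (Set.indicator_nonneg (fun _ _ => (Real.exp_pos _).le) _)
    (Finset.sum_nonneg fun _ _ => (Real.exp_pos _).le)

lemma sum_expMech (hU : U.Nonempty) : ∑ i ∈ U, expMech β f U i = 1 := by
  simp only [expMech, ← Finset.sum_div]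
  rw [Finset.sum_congr rfl fun i hi => Set.indicator_of_mem (Finset.mem_coe.2 hi) _]
  exact div_self (Finset.sum_pos (fun _ _ => Real.exp_pos _) hU).ne'

lemma expMech_le_exp {i₀ : ι} (hi₀ : i₀ ∈ U) (i : ι) :
    expMech β f U i ≤ Real.exp (β * (f i - f i₀)) := by
  have hle : Real.exp (β * f i₀) ≤ ∑ j ∈ U, Real.exp (β * f j) :=
    Finset.single_le_sum (f := fun j => Real.exp (β * f j)) (fun _ _ => (Real.exp_pos _).le) hi₀
  rw [mul_sub, Real.exp_sub, expMech]
  gcongr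
  exact Set.indicator_le_self' (fun _ _ => (Real.exp_pos _).le) i

open scoped Classical in
lemma one_sub_le_sum_expMech {s : ℝ} (hβ : 0 ≤ β) (hs : 0 ≤ s) {i₀ : ι} (hi₀ : i₀ ∈ U) {S : Set ι}
    (hS : ∀ i ∈ U, f i₀ - s ≤ f i → i ∈ S) :
    1 - (U.card - 1) * Real.exp (-(β * s)) ≤ ∑ i ∈ U with i ∈ S, expMech β f U i := by
  have hbad : ∑ i ∈ U with i ∉ S, expMech β f U i ≤ (U.card - 1) * Real.exp (-(β * s)) := by
    have hsub : (U.filter fun i => i ∉ S) ⊆ U.erase i₀ := fun i hi => by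
      obtain ⟨hiU, hiS⟩ := Finset.mem_filter.1 hi
      refine Finset.mem_erase.2 ⟨fun h => hiS ?_, hiU⟩
      exact h ▸ hS i₀ hi₀ (sub_le_self _ hs)
    have hcard : ((U.filter fun i => i ∉ S).card : ℝ) ≤ U.card - 1 := by
      rw [← Finset.cast_card_erase_of_mem hi₀]
      exact_mod_cast Finset.card_le_card hsub
    refine (Finset.sum_le_card_nsmul _ _ (Real.exp (-(β * s))) fun i hi => ?_).trans ?_
    · obtain ⟨hiU, hiS⟩ := Finset.mem_filter.1 hi
      have hlt : f i < f i₀ - s := not_le.1 (mt (hS i hiU) hiS)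
      refine (expMech_le_exp hi₀ i).trans (Real.exp_le_exp.2 ?_)
      nlinarith
    · rw [nsmul_eq_mul]
      gcongr
  have hsum := Finset.sum_filter_add_sum_filter_not U (· ∈ S) (expMech β f U)
  rw [sum_expMech ⟨i₀, hi₀⟩] at hsum
  linarith

open scoped Classical in
lemma ofReal_sum_expMech_le (hUH : U ⊆ H) (S : Set ι) :
    ENNReal.ofReal (∑ i ∈ U with i ∈ S, expMech β f U i) ≤
      ∑ i ∈ H, S.indicator (fun i => ENNReal.ofReal (expMech β f U i)) i := by
  rw [ENNReal.ofReal_sum_of_nonneg fun i _ => expMech_nonneg i, Finset.sum_filter]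
  exact Finset.sum_le_sum_of_subset hUH

variable {n : ℕ} {α δ : ℝ} {top : ℕ → Finset ι} {S : Set ι}

lemma mul_lmmNoise_lmmRank_le_le_lmmProb (hα : 0 ≤ α) (hH : H.Nonempty)
    (htop : ∀ ℓ ∈ Finset.Icc 1 H.card, IsTopSet H f ℓ (top ℓ)) {s : ℝ} (hs : 0 ≤ s)
    (hS : ∀ i ∈ H, (∀ j ∈ H, f j - s ≤ f i) → i ∈ S) (m : ℕ) :
    ENNReal.ofReal (1 - (m - 1) * Real.exp (-(n * α / 6 * s))) *
        lmmNoise α H.card {w | lmmRank n α δ H f w.1 w.2.1 w.2.2 ≤ m} ≤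
      lmmProb n α δ H f top S := by
  classical
  rw [← setLIntegral_const]
  refine (setLIntegral_mono' (measurableSet_lmmRank_le H f n α δ m) fun w hw => ?_).trans
    (setLIntegral_le_lintegral _ _)
  set ℓ := lmmRank n α δ H f w.1 w.2.1 w.2.2
  have hℓ : 1 ≤ ℓ := one_le_lmmRank hH
  have hU := htop ℓ (Finset.mem_Icc.2 ⟨hℓ, lmmRank_le_card⟩)
  obtain ⟨i₀, hi₀, hmax⟩ := hU.exists_mem_forall_le hℓ
  have hcard : ((top ℓ).card : ℝ) ≤ m := by
    rw [hU.2.1]; exact_mod_cast hw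
  calc ENNReal.ofReal (1 - (m - 1) * Real.exp (-(n * α / 6 * s)))
      ≤ ENNReal.ofReal (1 - ((top ℓ).card - 1) * Real.exp (-(n * α / 6 * s))) := by gcongr
    _ ≤ ENNReal.ofReal (∑ i ∈ top ℓ with i ∈ S, expMech (n * α / 6) f (top ℓ) i) :=
        ENNReal.ofReal_le_ofReal <| one_sub_le_sum_expMech (by positivity) hs hi₀
          fun i hi hle => hS i (hU.1 hi) fun j hj => (sub_le_sub_right (hmax j hj) s).trans hle
    _ ≤ _ := ofReal_sum_expMech_le hU.1 S

end ExponentialMechanism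

section SuccessProbability

variable {n m : ℕ} {α δ : ℝ}

lemma bigThreshold_le (hm : 1 ≤ m) (hα : 0 < α) (hα1 : α ≤ 1) (hδ : 0 < δ) (hδ1 : δ ≤ 1) :
    bigThreshold n α δ m ≤ (39 * Real.log (3 * m / δ) + 6) / (n * α) := by
  have hm1 : (1 : ℝ) ≤ m := by exact_mod_cast hm
  have hfirst : Real.log (3 / (2 * δ)) ≤ Real.log (3 * m / δ) := by
    gcongr <;> linarith
  have hsecond : Real.log (3 / δ) ≤ Real.log (3 * m / δ) := by
    gcongr; linarith
  have hthird : Real.log (3 * m * (m + 1) / δ) ≤ 2 * Real.log (3 * m / δ) := by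
    have hfactor : m + 1 ≤ 3 * m / δ := (le_div_iff₀ hδ).2 (by nlinarith)
    calc Real.log (3 * m * (m + 1) / δ) = Real.log (3 * m / δ * (m + 1)) := by ring_nf
      _ ≤ Real.log ((3 * m / δ) ^ 2) := by rw [sq]; gcongr
      _ = 2 * Real.log (3 * m / δ) := by rw [Real.log_pow, Nat.cast_two]
  calc bigThreshold n α δ m
      = (3 * Real.log (3 / (2 * δ)) + 6 * Real.log (3 / δ) + 12 * Real.log (3 * m * (m + 1) / δ)
          + 6 * Real.log (3 * m / δ) + 6 * α) / (n * α) := by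
        rw [bigThreshold, tThreshold]; field_simp; ring
    _ ≤ _ := by gcongr <;> linarith

variable {ι : Type*} {H : Finset ι} {f : ι → ℝ}

lemma one_sub_le_lmmNoise_lmmRank_le (hn : 0 < n) (hα : 0 < α) (hα1 : α ≤ 1) (hδ : 0 < δ)
    (hδ1 : δ ≤ 1) (hm : 1 ≤ m) {g : ℝ} (hg : 60 * Real.log (3 * m / δ) + 6 ≤ n * α * g)
    (hgap : m < H.card → kthHighest H f (m + 1) ≤ kthHighest H f 1 - g) :
    ENNReal.ofReal (1 - δ / 2) ≤
      lmmNoise α H.card {w | lmmRank n α δ H f w.1 w.2.1 w.2.2 ≤ m} := by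
  set L := Real.log (3 / δ) with hL
  have hL0 : 0 ≤ L := Real.log_nonneg ((one_le_div hδ).2 (by linarith))
  have htail (b : ℝ) (hb : 0 < b) : Real.exp (-(b * L / b)) = δ / 3 := by
    rw [mul_div_cancel_left₀ _ hb.ne', Real.exp_neg, Real.exp_log (by positivity), inv_div]
  refine le_trans ?_ (laplace_mul_le_lmmNoise_lmmRank_le hn hα hm
    (z := -(3 / α * L)) (g := 6 / α * L) (y := 12 / α * L) fun hcard => ?_)
  · rw [laplace_Ioi_neg (by positivity) (by positivity),
      laplace_Iic (by positivity) (by positivity), laplace_Iic (by positivity) (by positivity),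
      htail _ (by positivity), htail _ (by positivity), htail _ (by positivity),
      ← ENNReal.ofReal_mul (by linarith), ← ENNReal.ofReal_mul (by linarith)]
    refine ENNReal.ofReal_le_ofReal ?_
    linarith [one_add_mul_le_pow (a := -(δ / 6)) (by linarith) 3]
  · have hLle : L ≤ Real.log (3 * m / δ) := by
      have hm1 : (1 : ℝ) ≤ m := by exact_mod_cast hm
      rw [hL]; gcongr; linarith
    have hnoise : (12 / α * L + 6 / α * L) / n - -(3 / α * L) / n = 21 * L / (n * α) := by
      field_simp; ring
    have htotal : 21 * L / (n * α) + (39 * Real.log (3 * m / δ) + 6) / (n * α) ≤ g := by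
      rw [← add_div, div_le_iff₀ (by positivity)]
      linarith
    linarith [hgap hcard, bigThreshold_le (n := n) hm hα hα1 hδ hδ1]

/-- A lower bound, valid for all `δ ≥ 1 / 2`, for the probability that the loop of the mechanism
ends at rank `1`: that of `Z > 210 / α`, `G ≤ 0` and `Z₁ ≤ 0`. -/
noncomputable def earlyStopProb : ℝ :=
  Real.exp (-70) / 8

lemma earlyStopProb_pos : 0 < earlyStopProb := by
  unfold earlyStopProb
  positivity

lemma earlyStopProb_le_half : earlyStopProb ≤ 1 / 2 := by
  have := Real.exp_le_one_iff.2 (by norm_num : (-70 : ℝ) ≤ 0)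
  unfold earlyStopProb
  linarith

lemma earlyStopProb_le_lmmNoise_lmmRank_le_one (hn : 0 < n) (hα : 0 < α) (hα1 : α ≤ 1)
    (hδ : 1 / 2 ≤ δ) (hδ1 : δ ≤ 1) :
    ENNReal.ofReal earlyStopProb ≤
      lmmNoise α H.card {w | lmmRank n α δ H f w.1 w.2.1 w.2.2 ≤ 1} := by
  refine le_trans ?_ (laplace_mul_le_lmmNoise_lmmRank_le hn hα le_rfl
    (z := 210 / α) (g := 0) (y := 0) fun hcard => ?_)
  · rw [laplace_Ioi (by positivity) (by positivity), laplace_Iic (by positivity) le_rfl,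
      laplace_Iic (by positivity) le_rfl, ← ENNReal.ofReal_mul (by norm_num),
      ← ENNReal.ofReal_mul (by positivity), div_div_div_cancel_right₀ hα.ne', earlyStopProb]
    refine ENNReal.ofReal_le_ofReal (le_of_eq ?_)
    norm_num
    ring
  · have hkth : kthHighest H f (1 + 1) ≤ kthHighest H f 1 :=
      kthHighest_le_of_forall_notMem (T := ∅) hcard (by simp) fun i hi _ => le_kthHighest_one hi
    have hlog : Real.log (3 * (1 : ℕ) / δ) ≤ 5 := by
      have hratio : 3 * ((1 : ℕ) : ℝ) / δ ≤ 6 := by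
        rw [div_le_iff₀ (by linarith)]; push_cast; linarith
      linarith [Real.log_le_sub_one_of_pos (x := 3 * ((1 : ℕ) : ℝ) / δ) (by positivity)]
    have hthreshold : (39 * Real.log (3 * (1 : ℕ) / δ) + 6) / (n * α) ≤ 210 / α / n := by
      rw [div_div, mul_comm α]
      gcongr
      linarith
    rw [add_zero, zero_div, zero_add]
    linarith [bigThreshold_le (n := n) le_rfl hα hα1 (by linarith : 0 < δ) hδ1]

variable {top : ℕ → Finset ι} {S : Set ι}

lemma one_sub_le_lmmProb_of_gap (hn : 0 < n) (hα : 0 < α) (hα1 : α ≤ 1) (hδ : 0 < δ)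
    (hδ1 : δ ≤ 1) (hH : H.Nonempty) (htop : ∀ ℓ ∈ Finset.Icc 1 H.card, IsTopSet H f ℓ (top ℓ))
    (hm : 1 ≤ m) {g : ℝ} (hg : 60 * Real.log (3 * m / δ) + 6 ≤ n * α * g)
    (hgap : m < H.card → kthHighest H f (m + 1) ≤ kthHighest H f 1 - g)
    (hS : ∀ i ∈ H, (∀ j ∈ H, f j - 6 / (n * α) * Real.log (2 * m / δ) ≤ f i) → i ∈ S) :
    ENNReal.ofReal (1 - δ) ≤ lmmProb n α δ H f top S := by
  have hm1 : (1 : ℝ) ≤ m := by exact_mod_cast hm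
  have hs : 0 ≤ 6 / (n * α) * Real.log (2 * m / δ) :=
    mul_nonneg (by positivity) (Real.log_nonneg ((one_le_div hδ).2 (by linarith)))
  have hexp : Real.exp (-(n * α / 6 * (6 / (n * α) * Real.log (2 * m / δ)))) = δ / (2 * m) := by
    rw [← mul_assoc, div_mul_div_cancel₀ (by norm_num), div_self (by positivity), one_mul,
      Real.exp_neg, Real.exp_log (by positivity), inv_div]
  have hmech : 1 - δ / 2 ≤ 1 - (m - 1) * (δ / (2 * m)) := by
    have hhalf : m * (δ / (2 * m)) = δ / 2 := by field_simp
    linarith [div_nonneg hδ.le (by positivity : (0 : ℝ) ≤ 2 * m)]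
  calc ENNReal.ofReal (1 - δ)
      ≤ ENNReal.ofReal ((1 - δ / 2) * (1 - δ / 2)) :=
        ENNReal.ofReal_le_ofReal (by nlinarith)
    _ = ENNReal.ofReal (1 - δ / 2) * ENNReal.ofReal (1 - δ / 2) :=
        ENNReal.ofReal_mul (by linarith)
    _ ≤ ENNReal.ofReal (1 - (m - 1) * (δ / (2 * m))) *
          lmmNoise α H.card {w | lmmRank n α δ H f w.1 w.2.1 w.2.2 ≤ m} :=
        mul_le_mul' (ENNReal.ofReal_le_ofReal hmech)
          (one_sub_le_lmmNoise_lmmRank_le hn hα hα1 hδ hδ1 hm hg hgap)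
    _ ≤ lmmProb n α δ H f top S := by
        rw [← hexp]
        exact mul_lmmNoise_lmmRank_le_le_lmmProb hα.le hH htop hs hS m

lemma earlyStopProb_le_lmmProb (hn : 0 < n) (hα : 0 < α) (hα1 : α ≤ 1)
    (hδ : 1 / 2 ≤ δ) (hδ1 : δ ≤ 1) (hH : H.Nonempty)
    (htop : ∀ ℓ ∈ Finset.Icc 1 H.card, IsTopSet H f ℓ (top ℓ))
    (hS : ∀ i ∈ H, (∀ j ∈ H, f j ≤ f i) → i ∈ S) :
    ENNReal.ofReal earlyStopProb ≤ lmmProb n α δ H f top S := by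
  refine (earlyStopProb_le_lmmNoise_lmmRank_le_one (H := H) (f := f) hn hα hα1 hδ hδ1).trans ?_
  simpa using mul_lmmNoise_lmmRank_le_le_lmmProb hα.le hH htop le_rfl (by simpa using hS) 1

end SuccessProbability

section Shells

variable {X : Type*} [MeasurableSpace X] {P : Measure (X × Bool)} {H : Finset (X → Bool)}
  {hH : H.Nonempty} {d n t : ℕ} {α δ δ₀ C₀ C c : ℝ} {D : Fin n → X × Bool}

lemma exists_err_eq_minErr (P : Measure (X × Bool)) (hH : H.Nonempty) :
    ∃ h ∈ H, err P h = minErr P H hH :=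
  (Finset.exists_mem_eq_inf' hH (err P)).imp fun _ => And.imp_right Eq.symm

lemma err_le_of_forall_sub_le (hD : ∀ h ∈ H, |empErr h D - err P h| ≤ c) {h : X → Bool}
    (hh : h ∈ H) {s : ℝ} (hopt : ∀ j ∈ H, (1 - empErr j D) - s ≤ 1 - empErr h D) :
    err P h ≤ minErr P H hH + 2 * c + s := by
  obtain ⟨j, hj, hjmin⟩ := exists_err_eq_minErr P hH
  linarith [abs_le.1 (hD h hh), abs_le.1 (hD j hj), hopt j hj]

lemma kthHighest_card_shell_add_one_le (hD : ∀ h ∈ H, |empErr h D - err P h| ≤ c)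
    (hlt : (shell P H hH d n δ₀ C₀ t).card < H.card) :
    kthHighest H (fun h => 1 - empErr h D) ((shell P H hH d n δ₀ C₀ t).card + 1) ≤
      kthHighest H (fun h => 1 - empErr h D) 1 - (C₀ * t * rate d n δ₀ - 2 * c) := by
  refine kthHighest_le_of_forall_notMem hlt (Nat.lt_succ_self _) fun h hh hshell => ?_
  obtain ⟨j, hj, hjmin⟩ := exists_err_eq_minErr P hH
  have hfar : minErr P H hH + C₀ * t * rate d n δ₀ < err P h :=
    not_le.1 fun hle => hshell (Finset.mem_filter.2 ⟨hh, hle⟩)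
  linarith [abs_le.1 (hD h hh), abs_le.1 (hD j hj),
    le_kthHighest_one (f := fun h => 1 - empErr h D) hj]

lemma one_le_card_shell (hC₀ : 0 ≤ C₀) (t : ℕ) : 1 ≤ (shell P H hH d n δ₀ C₀ t).card := by
  obtain ⟨h, hh, hmin⟩ := exists_err_eq_minErr P hH
  refine Finset.card_pos.2 ⟨h, Finset.mem_filter.2 ⟨hh, hmin.trans_le ?_⟩⟩
  exact le_add_of_nonneg_right (mul_nonneg (by positivity) (Real.sqrt_nonneg _))

lemma tStar_spec (hC₀ : 0 < C₀) (hα : 0 < α) (hC : 0 < C) (hd : 1 ≤ d) (hn : 2 ≤ n) :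
    0 < tStar P H hH d n α δ δ₀ C₀ C ∧
      (Real.log (shell P H hH d n δ₀ C₀ (tStar P H hH d n α δ δ₀ C₀ C + 1)).card
        + Real.log (1 / δ)) / tStar P H hH d n α δ δ₀ C₀ C ≤
        C₀ * α * Real.sqrt (d * n * Real.log n) / C := by
  have hlog : 0 < Real.log n := Real.log_pos (by exact_mod_cast hn)
  have hbound : 0 < C₀ * α * Real.sqrt (d * n * Real.log n) / C := by positivity
  obtain ⟨N, hN⟩ := exists_nat_ge ((Real.log H.card + Real.log (1 / δ)) /
    (C₀ * α * Real.sqrt (d * n * Real.log n) / C))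
  refine Nat.sInf_mem (s := {t : ℕ | 0 < t ∧ (Real.log (shell P H hH d n δ₀ C₀ (t + 1)).card
    + Real.log (1 / δ)) / t ≤ C₀ * α * Real.sqrt (d * n * Real.log n) / C})
    ⟨N + 1, Nat.succ_pos N, ?_⟩
  have hcard : Real.log (shell P H hH d n δ₀ C₀ (N + 1 + 1)).card ≤ Real.log H.card :=
    Real.log_le_log (by exact_mod_cast one_le_card_shell hC₀.le _)
      (by exact_mod_cast Finset.card_filter_le _ _)
  rw [div_le_iff₀ hbound] at hN
  rw [div_le_iff₀ (by positivity)]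
  push_cast
  linarith

lemma sqrt_mul_log_le_mul_rate (hn : 1 ≤ n) (h0 : 0 < δ₀) (h1 : δ₀ ≤ 1) :
    Real.sqrt (d * n * Real.log n) ≤ n * rate d n δ₀ := by
  have hlog : Real.log n ≤ Real.log (n / δ₀) :=
    Real.log_le_log (by positivity) (le_div_self (by positivity) h0 h1)
  have hsq : (n : ℝ) ^ 2 * (d * Real.log (n / δ₀) / n) = d * n * Real.log (n / δ₀) := by
    field_simp
  calc Real.sqrt (d * n * Real.log n) ≤ Real.sqrt (n ^ 2 * (d * Real.log (n / δ₀) / n)) := by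
        rw [hsq]; gcongr
    _ = n * rate d n δ₀ := by rw [Real.sqrt_mul (by positivity), Real.sqrt_sq (by positivity), rate]

lemma log_card_shell_tStar_div_mul_le (hC₀ : 0 < C₀) (hα : 0 < α) (hδ : 0 < δ) (h0 : 0 < δ₀)
    (h1 : δ₀ ≤ 1) (hC : 0 < C) (hd : 1 ≤ d) (hn : 2 ≤ n) :
    Real.log ((shell P H hH d n δ₀ C₀ (tStar P H hH d n α δ δ₀ C₀ C + 1)).card / δ) * C ≤
      n * α * (C₀ * tStar P H hH d n α δ δ₀ C₀ C * rate d n δ₀) := by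
  obtain ⟨hpos, hle⟩ := tStar_spec (P := P) (hH := hH) (δ := δ) (δ₀ := δ₀) hC₀ hα hC hd hn
  set t := tStar P H hH d n α δ δ₀ C₀ C
  have hcard : (0 : ℝ) < (shell P H hH d n δ₀ C₀ (t + 1)).card := by
    exact_mod_cast one_le_card_shell hC₀.le _
  rw [← Real.log_mul hcard.ne' (by positivity), mul_one_div,
    div_le_iff₀ (by exact_mod_cast hpos), div_mul_eq_mul_div, le_div_iff₀ hC] at hle
  calc _ ≤ C₀ * α * Real.sqrt (d * n * Real.log n) * t := hle
    _ ≤ C₀ * α * (n * rate d n δ₀) * t := by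
        gcongr; exact sqrt_mul_log_le_mul_rate (by omega) h0 h1
    _ = _ := by ring

/-- The fraction `κ` of the width `C₀ t ρ` by which the hypotheses outside the shell `t + 1` are
guaranteed to fall short of the best one empirically, when `C₀ ≥ (1 + θ) c₀` or `t ≥ 2`. -/
noncomputable def marginRatio (θ : ℝ) : ℝ :=
  min (1 / 2) (θ / (1 + θ))

lemma marginRatio_pos {θ : ℝ} (hθ : 0 < θ) : 0 < marginRatio θ :=
  lt_min (by norm_num) (by positivity)

lemma marginRatio_mul_le {θ t : ℝ} (hθ : 0 < θ) (hC₀ : 0 ≤ C₀) (hc : c ≤ C₀) (ht : 1 ≤ t)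
    (hor : (1 + θ) * c ≤ C₀ ∨ 2 ≤ t) :
    marginRatio θ * (C₀ * t) ≤ C₀ * (t + 1) - 2 * c := by
  rcases hor with hlarge | htwo
  · have hκ1 : θ / (1 + θ) ≤ 1 := (div_le_one (by positivity)).2 (by linarith)
    have hc' : c ≤ (1 - θ / (1 + θ)) * C₀ := by
      rw [one_sub_div (by positivity), add_sub_cancel_right, one_div_mul_eq_div,
        le_div_iff₀' (by positivity)]
      exact hlarge
    have hnonneg : 0 ≤ C₀ * (t - 1) := mul_nonneg hC₀ (by linarith)
    calc marginRatio θ * (C₀ * t) ≤ θ / (1 + θ) * (C₀ * t) := by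
          gcongr; exact min_le_right _ _
      _ ≤ C₀ * (t + 1) - 2 * ((1 - θ / (1 + θ)) * C₀) := by
          linarith [mul_le_mul_of_nonneg_right hκ1 hnonneg,
            mul_nonneg (div_nonneg hθ.le (by positivity : 0 ≤ 1 + θ)) hC₀]
      _ ≤ C₀ * (t + 1) - 2 * c := by gcongr
  · calc marginRatio θ * (C₀ * t) ≤ 1 / 2 * (C₀ * t) := by
          gcongr; exact min_le_left _ _
      _ ≤ C₀ * (t + 1) - 2 * c := by nlinarith

end Shells

section KeyEstimate

/-- The constant `A` of the theorem. The summand `16` is `2 * 8`, where `8` bounds the constant of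
uniform convergence; the rest is the loss of the exponential mechanism on a shell. -/
noncomputable def errorFactor : ℝ :=
  16 + 6 * (1 + 1 / earlyStopProb)

/-- The constant `B(θ)` of the theorem, chosen so that for `C ≥ B(θ)` the margin beyond the shell
`t* + 1` pays for the thresholds of the mechanism. -/
noncomputable def marginConstant (θ : ℝ) : ℝ :=
  (60 + 126 / earlyStopProb) / marginRatio θ

lemma errorFactor_pos : 0 < errorFactor := by
  have := earlyStopProb_pos
  unfold errorFactor
  positivity

lemma marginConstant_pos {θ : ℝ} (hθ : 0 < θ) : 0 < marginConstant θ := by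
  have := earlyStopProb_pos
  have := marginRatio_pos hθ
  unfold marginConstant
  positivity

lemma log_mul_le_of_le_log {a p x : ℝ} (ha : 1 ≤ a) (hp : 0 < p) (hx : 0 < x)
    (hpx : p ≤ Real.log x) : Real.log (a * x) ≤ (1 + (a - 1) / p) * Real.log x := by
  have hscale : a - 1 ≤ (a - 1) * (Real.log x / p) :=
    le_mul_of_one_le_right (by linarith) ((one_le_div hp).2 hpx)
  calc Real.log (a * x) = Real.log a + Real.log x := Real.log_mul (by positivity) hx.ne'
    _ ≤ (a - 1) * (Real.log x / p) + Real.log x := by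
        gcongr
        exact (Real.log_le_sub_one_of_pos (by positivity)).trans hscale
    _ = (1 + (a - 1) / p) * Real.log x := by ring

lemma one_sub_le_log_div {m δ : ℝ} (hm : 1 ≤ m) (hδ : 0 < δ) : 1 - δ ≤ Real.log (m / δ) := by
  rw [Real.log_div (by positivity) hδ.ne']
  linarith [Real.log_nonneg hm, Real.log_le_sub_one_of_pos hδ]

variable {X : Type*} [MeasurableSpace X] {P : Measure (X × Bool)} {H : Finset (X → Bool)}
  {hH : H.Nonempty} {d n : ℕ} {α δ δ₀ C₀ C c θ : ℝ} {D : Fin n → X × Bool}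
  {top : ℕ → Finset (X → Bool)}

lemma sixty_mul_log_add_six_le_margin (hθ : 0 < θ) (hC₀ : 0 < C₀) (hα : 0 < α) (hδ : 0 < δ)
    (h0 : 0 < δ₀) (h1 : δ₀ ≤ 1) (hC : marginConstant θ ≤ C) (hd : 1 ≤ d) (hn : 2 ≤ n) {m t : ℕ}
    (ht : t = tStar P H hH d n α δ δ₀ C₀ C) (hm : m = (shell P H hH d n δ₀ C₀ (t + 1)).card)
    (hlog : earlyStopProb ≤ Real.log (m / δ)) :
    60 * Real.log (3 * m / δ) + 6 ≤
      n * α * (marginRatio θ * (C₀ * t) * rate d n δ₀) := by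
  have hp := earlyStopProb_pos
  have hκ := marginRatio_pos hθ
  have hm0 : (0 : ℝ) < m := by rw [hm]; exact_mod_cast one_le_card_shell hC₀.le _
  have hlog0 : 0 ≤ Real.log (m / δ) := hp.le.trans hlog
  have hscaled : 60 + 126 / earlyStopProb ≤ marginRatio θ * C := (div_le_iff₀' hκ).1 hC
  have htStar := log_card_shell_tStar_div_mul_le (P := P) (hH := hH) hC₀ hα hδ h0 h1
    ((marginConstant_pos hθ).trans_le hC) hd hn
  rw [← ht, ← hm] at htStar
  calc 60 * Real.log (3 * m / δ) + 6
      ≤ 60 * ((1 + (3 - 1) / earlyStopProb) * Real.log (m / δ))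
          + 6 * (Real.log (m / δ) / earlyStopProb) := by
        rw [mul_div_assoc]
        gcongr
        · exact log_mul_le_of_le_log (by norm_num) hp (by positivity) hlog
        · exact le_mul_of_one_le_right (by norm_num) ((one_le_div hp).2 hlog)
    _ = (60 + 126 / earlyStopProb) * Real.log (m / δ) := by ring
    _ ≤ marginRatio θ * C * Real.log (m / δ) := by gcongr
    _ = marginRatio θ * (Real.log (m / δ) * C) := by ring
    _ ≤ marginRatio θ * (n * α * (C₀ * t * rate d n δ₀)) := by gcongr
    _ = n * α * (marginRatio θ * (C₀ * t) * rate d n δ₀) := by ring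

lemma one_sub_le_lmmProb_of_le_earlyStopProb (hn : 0 < n) (hα : 0 < α) (hα1 : α ≤ 1) (hδ1 : δ ≤ 1)
    (hp : 1 - δ ≤ earlyStopProb)
    (htop : ∀ ℓ ∈ Finset.Icc 1 H.card, IsTopSet H (fun h => 1 - empErr h D) ℓ (top ℓ))
    (hc : c ≤ 8) (hD : ∀ h ∈ H, |empErr h D - err P h| ≤ c * rate d n δ₀) {x : ℝ} (hx : 0 ≤ x) :
    ENNReal.ofReal (1 - δ) ≤ lmmProb n α δ H (fun h => 1 - empErr h D) top
      {h | err P h ≤ minErr P H hH + errorFactor * (rate d n δ₀ + x)} := by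
  have hρ : 0 ≤ rate d n δ₀ := Real.sqrt_nonneg _
  have hA : 16 ≤ errorFactor :=
    le_add_of_nonneg_right (by have := earlyStopProb_pos; positivity)
  refine (ENNReal.ofReal_le_ofReal hp).trans (earlyStopProb_le_lmmProb hn hα hα1
    (by linarith [earlyStopProb_le_half]) hδ1 hH htop fun h hh hopt => ?_)
  calc err P h ≤ minErr P H hH + 2 * (c * rate d n δ₀) + 0 :=
        err_le_of_forall_sub_le hD hh (by simpa using hopt)
    _ ≤ minErr P H hH + 16 * (rate d n δ₀ + x) := by nlinarith
    _ ≤ minErr P H hH + errorFactor * (rate d n δ₀ + x) := by gcongr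

lemma one_sub_le_lmmProb_of_earlyStopProb_le_log (hn : 0 < n) (hα : 0 < α) (hα1 : α ≤ 1)
    (hδ : 0 < δ) (hδ1 : δ ≤ 1)
    (htop : ∀ ℓ ∈ Finset.Icc 1 H.card, IsTopSet H (fun h => 1 - empErr h D) ℓ (top ℓ))
    (hc : c ≤ 8) (hD : ∀ h ∈ H, |empErr h D - err P h| ≤ c * rate d n δ₀) {m : ℕ} (hm : 1 ≤ m)
    {g : ℝ} (hg : 60 * Real.log (3 * m / δ) + 6 ≤ n * α * g)
    (hgap : m < H.card → kthHighest H (fun h => 1 - empErr h D) (m + 1) ≤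
      kthHighest H (fun h => 1 - empErr h D) 1 - g)
    (hlog : earlyStopProb ≤ Real.log (m / δ)) :
    ENNReal.ofReal (1 - δ) ≤ lmmProb n α δ H (fun h => 1 - empErr h D) top
      {h | err P h ≤ minErr P H hH + errorFactor *
        (rate d n δ₀ + Real.log (m / δ) / (α * n))} := by
  have hp := earlyStopProb_pos
  have hρ : 0 ≤ rate d n δ₀ := Real.sqrt_nonneg _
  have hlog2 : Real.log (2 * m / δ) ≤ (1 + 1 / earlyStopProb) * Real.log (m / δ) := by
    have h := log_mul_le_of_le_log one_le_two hp (by positivity) hlog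
    rwa [← mul_div_assoc, show (2 : ℝ) - 1 = 1 by norm_num] at h
  refine one_sub_le_lmmProb_of_gap hn hα hα1 hδ hδ1 hH htop hm hg hgap fun h hh hopt => ?_
  calc err P h
      ≤ minErr P H hH + 2 * (c * rate d n δ₀) + 6 / (n * α) * Real.log (2 * m / δ) :=
        err_le_of_forall_sub_le hD hh hopt
    _ ≤ minErr P H hH + 2 * (8 * rate d n δ₀)
          + 6 / (n * α) * ((1 + 1 / earlyStopProb) * Real.log (m / δ)) := by gcongr
    _ = minErr P H hH + (16 * rate d n δ₀
          + 6 * (1 + 1 / earlyStopProb) * (Real.log (m / δ) / (α * n))) := by ring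
    _ ≤ minErr P H hH + errorFactor * (rate d n δ₀ + Real.log (m / δ) / (α * n)) := by
        rw [errorFactor, add_mul]
        gcongr
        · exact le_add_of_nonneg_right (div_nonneg (hp.le.trans hlog) (by positivity))
        · exact le_add_of_nonneg_left hρ

lemma one_sub_le_lmmProb_err_le (hθ : 0 < θ) (hC₀ : 0 < C₀) (hα : 0 < α) (hα1 : α ≤ 1)
    (hδ : 0 < δ) (hδ1 : δ ≤ 1) (h0 : 0 < δ₀) (h1 : δ₀ ≤ 1) (hC : marginConstant θ ≤ C)
    (hd : 1 ≤ d) (hn : 2 ≤ n) (hc8 : c ≤ 8) (hcC₀ : c ≤ C₀)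
    (hor : (1 + θ) * c ≤ C₀ ∨ 2 ≤ tStar P H hH d n α δ δ₀ C₀ C)
    (htop : ∀ ℓ ∈ Finset.Icc 1 H.card, IsTopSet H (fun h => 1 - empErr h D) ℓ (top ℓ))
    (hD : ∀ h ∈ H, |empErr h D - err P h| ≤ c * rate d n δ₀) :
    ENNReal.ofReal (1 - δ) ≤ lmmProb n α δ H (fun h => 1 - empErr h D) top
      {h | err P h ≤ minErr P H hH + errorFactor * (rate d n δ₀ +
        Real.log ((shell P H hH d n δ₀ C₀
          (tStar P H hH d n α δ δ₀ C₀ C + 1)).card / δ) / (α * n))} := by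
  obtain ⟨t, ht⟩ : ∃ t, t = tStar P H hH d n α δ δ₀ C₀ C := ⟨_, rfl⟩
  obtain ⟨m, hm⟩ : ∃ m, m = (shell P H hH d n δ₀ C₀ (t + 1)).card := ⟨_, rfl⟩
  rw [← ht] at hor ⊢
  rw [← hm]
  have ht1 : 1 ≤ t :=
    ht ▸ (tStar_spec hC₀ hα ((marginConstant_pos hθ).trans_le hC) hd hn).1
  have hm1 : 1 ≤ m := hm ▸ one_le_card_shell hC₀.le _
  have hlog : 1 - δ ≤ Real.log (m / δ) := one_sub_le_log_div (by exact_mod_cast hm1) hδ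
  rcases le_total (1 - δ) earlyStopProb with hp | hp
  · exact one_sub_le_lmmProb_of_le_earlyStopProb (by omega) hα hα1 hδ1 hp htop hc8 hD
      (div_nonneg (by linarith) (by positivity))
  · refine one_sub_le_lmmProb_of_earlyStopProb_le_log (by omega) hα hα1 hδ hδ1 htop hc8 hD hm1
      (sixty_mul_log_add_six_le_margin hθ hC₀ hα hδ h0 h1 hC hd hn ht hm (hp.trans hlog))
      (fun hlt => ?_) (hp.trans hlog)
    rw [hm] at hlt ⊢
    refine (kthHighest_card_shell_add_one_le hD hlt).trans (sub_le_sub_left ?_ _)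
    rw [Nat.cast_add_one, ← mul_assoc 2, ← sub_mul]
    gcongr
    · exact Real.sqrt_nonneg _
    · exact marginRatio_mul_le hθ hC₀.le hcC₀ (by exact_mod_cast ht1)
        (hor.imp_right fun h => by exact_mod_cast h)

lemma ofReal_one_sub_sub_le_lintegral {Ω : Type*} [MeasurableSpace Ω] {μ : Measure Ω} {E : Set Ω}
    (hE : MeasurableSet E) {F : Ω → ℝ≥0∞} {a b : ℝ} (ha : 0 ≤ a) (hb : 0 ≤ b) (hb1 : b ≤ 1)
    (hμ : ENNReal.ofReal (1 - a) ≤ μ E) (hF : ∀ ω ∈ E, ENNReal.ofReal (1 - b) ≤ F ω) :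
    ENNReal.ofReal (1 - a - b) ≤ ∫⁻ ω, F ω ∂μ :=
  calc ENNReal.ofReal (1 - a - b) ≤ ENNReal.ofReal ((1 - b) * (1 - a)) :=
        ENNReal.ofReal_le_ofReal (by nlinarith)
    _ = ENNReal.ofReal (1 - b) * ENNReal.ofReal (1 - a) := ENNReal.ofReal_mul (by linarith)
    _ ≤ ENNReal.ofReal (1 - b) * μ E := by gcongr
    _ = ∫⁻ _ in E, ENNReal.ofReal (1 - b) ∂μ := (setLIntegral_const _ _).symm
    _ ≤ ∫⁻ ω in E, F ω ∂μ := setLIntegral_mono' hE hF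
    _ ≤ ∫⁻ ω, F ω ∂μ := setLIntegral_le_lintegral _ _

end KeyEstimate

end PrivMax

theorem corollary2 :
    ∃ A : ℝ, 0 < A ∧ ∀ θ : ℝ, 0 < θ → ∃ B : ℝ, 0 < B ∧
      ∀ (X : Type*) [MeasurableSpace X] (P : Measure (X × Bool)) [IsProbabilityMeasure P]
        (H : Finset (X → Bool)) (hH : H.Nonempty) (d n : ℕ) (α δ δ₀ C₀ C : ℝ)
        (top : (Fin n → X × Bool) → ℕ → Finset (X → Bool)),
        (∀ h ∈ H, Measurable h) → vcDim H ≤ d → 1 ≤ d → 2 ≤ n →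
        0 < α → α < 1 → 0 < δ → δ < 1 → 0 < δ₀ → δ₀ < 1 →
        0 < C₀ → ucConstant P H d n δ₀ ≤ C₀ → B ≤ C →
        ((1 + θ) * ucConstant P H d n δ₀ ≤ C₀ ∨ 2 ≤ tStar P H hH d n α δ δ₀ C₀ C) →
        (∀ D, ∀ ℓ ∈ Finset.Icc 1 H.card, IsTopSet H (fun h => 1 - empErr h D) ℓ (top D ℓ)) →
        ENNReal.ofReal (1 - δ₀ - δ) ≤
          ∫⁻ D, lmmProb n α δ H (fun h => 1 - empErr h D) (top D)
              {h | err P h ≤ minErr P H hH + A * (rate d n δ₀ +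
                Real.log ((shell P H hH d n δ₀ C₀
                  (tStar P H hH d n α δ δ₀ C₀ C + 1)).card / δ) / (α * n))}
            ∂(Measure.pi fun _ : Fin n => P) := by
  refine ⟨errorFactor, errorFactor_pos, fun θ hθ => ⟨marginConstant θ, marginConstant_pos hθ, ?_⟩⟩
  intro X _ P _ H hH d n α δ δ₀ C₀ C top hmeas hvc hd hn hα hα1 hδ hδ1 hδ₀ hδ₀1 hC₀ hcC₀ hC hor htop
  exact ofReal_one_sub_sub_le_lintegral
    (measurableSet_forall_abs_empErr_sub_err_le P hmeas n _) hδ₀.le hδ.le hδ1.le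
    (le_measure_forall_deviation_le_ucConstant_mul_rate P hmeas hvc hd hn hδ₀ hδ₀1)
    fun D hD => one_sub_le_lmmProb_err_le hθ hC₀ hα hα1.le hδ hδ1.le hδ₀ hδ₀1.le hC hd hn
      (ucConstant_le_eight P hmeas hvc hd hn hδ₀ hδ₀1) hcC₀ hor (htop D) hD
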